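/- Fix $\varepsilon\in(0,1/2)$. There are constants $C>0$ and $\delta>0$, depending only on $\varepsilon$, such that the following holds for all $\rho>0$ and $\mathfrak a>0$ with $\rho\mathfrak a^3<\delta$. Let $\ell=(\rho\mathfrak a)^{-1/2}(\rho\mathfrak a^3)^{\varepsilon}$. Let $\lambda_\ell$ be the smallest eigenvalue, and $f_\ell$ the corresponding eigenfunction, of the Neumann problem on the ball $\{x\in\mathbb R^3:|x|\le\ell\}$ with a hard core of radius $\mathfrak a$: $f_\ell$ is continuous on the closed ball, $f_\ell(x)=0$ for $|x|<\mathfrak a$, $-\Delta f_\ell=\lambda_\ell f_\ell$ for $\mathfrak a<|x|<\ell$, and $\partial_r f_\ell=0$ on $|x|=\ell$. Normalize $f_\ell$ by $f_\ell(x)=1$ for $|x|=\ell$, and extend it by $f_\ell(x)=1$ for $|x|\ge\ell$. For $N\ge2$ let $\Lambda=[-L/2,L/2]^3$ with periodic boundary conditions, where $L^3=|\Lambda|=N/\rho$, and let $f_{ij}=f_\ell(x_i-x_j)$ and $V_{12}=2\lambda_\ell\,\chi_\ell(x_1-x_2)$, where $\chi_\ell$ is the characteristic function of $\{|x|\le\ell\}$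 and differences are taken on the torus (represented by vectors in $[-L/2,L/2]^3$). Then $\int_{\Lambda^N}\prod_{i<j}f_{ij}^2\,dx_1\cdots dx_N>0$ for all large $N$, and $$\limsup_{\substack{N,|\Lambda|\to\infty\\ N/|\Lambda|=\rho}}\ \frac{N-1}{2}\,\frac{\int_{\Lambda^N}V_{12}\prod_{1\le i<j\le N}f_{ij}^2\,dx_1\cdots dx_N}{\int_{\Lambda^N}\prod_{1\le i<j\le N}f_{ij}^2\,dx_1\cdots dx_N}\ \le\ 4\pi\mathfrak a\rho+C\rho\mathfrak a\,(\rho\mathfrak a^3)^{1/2-\varepsilon}.$$ -/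

import Mathlib

open scoped Topology

namespace HardSphere

/-- Three-dimensional Euclidean space. -/
abbrev R3 : Type := EuclideanSpace ℝ (Fin 3)

/-- The open spherical shell `{x : a < |x| < l}`. -/
def shell (a l : ℝ) : Set R3 := {x | a < ‖x‖ ∧ ‖x‖ < l}

/-- `g` is a (classical) eigenfunction, with eigenvalue `mu`, of the hard-core Neumann problem on
the ball `{|x| ≤ l}`: `g` vanishes for `|x| < a`, solves `-Δ g = mu g` in the shell `a < |x| < l`,
and its radial derivative vanishes on the sphere `|x| = l` (it extends continuously by `0` from the
shell to this sphere). Continuity on the closed ball gives the Dirichlet condition on `|x| = a`. -/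
structure IsNeumannEigenpair (a l mu : ℝ) (g : R3 → ℝ) : Prop where
  continuousOn : ContinuousOn g (Metric.closedBall 0 l)
  contDiffOn : ContDiffOn ℝ 2 g (shell a l)
  hard_core : ∀ x : R3, ‖x‖ < a → g x = 0
  eigen : ∀ x ∈ shell a l, -(Laplacian.laplacian g x) = mu * g x
  neumann : ∀ x : R3, ‖x‖ = l →
    Filter.Tendsto (fun y : R3 => fderiv ℝ g y (‖y‖⁻¹ • y)) (𝓝[shell a l] x) (𝓝 0)
  nontrivial : ∃ x ∈ Metric.closedBall (0 : R3) l, g x ≠ 0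

/-- `lam` is the smallest eigenvalue of the hard-core Neumann problem on the ball of radius `l`, and
`f` is an eigenfunction for it, normalized by `f = 1` on `|x| = l` and extended by `1` to
`|x| ≥ l`. -/
structure IsNeumannGroundState (a l lam : ℝ) (f : R3 → ℝ) : Prop where
  eigenpair : IsNeumannEigenpair a l lam f
  smallest : ∀ (mu : ℝ) (g : R3 → ℝ), IsNeumannEigenpair a l mu g → lam ≤ mu
  eq_one : ∀ x : R3, l ≤ ‖x‖ → f x = 1

/-- The representative of `x` modulo `L ℤ³` in the cube `[-L/2, L/2]³`. Its norm is the distance of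
`x` to `0` on the torus of side length `L`. -/
noncomputable def torusRep (L : ℝ) (x : R3) : R3 :=
  WithLp.toLp 2 (fun k => x k - L * (round (x k / L) : ℝ))

/-- The configuration space of `N` particles in the cube `[-L/2, L/2]³`. -/
def box (N : ℕ) (L : ℝ) : Set (Fin N → R3) :=
  {x | ∀ i k, x i k ∈ Set.Icc (-L / 2) (L / 2)}

/-- The squared Bijl-Dingle-Jastrow factor `∏_{i<j} f(x_i - x_j)²` with periodic boundary
conditions on the cube of side length `L`. -/
noncomputable def jastrowSq (N : ℕ) (L : ℝ) (f : R3 → ℝ) (x : Fin N → R3) : ℝ :=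
  ∏ i : Fin N, ∏ j ∈ Finset.Ioi i, f (torusRep L (x i - x j)) ^ 2

/-- The squared norm `∫ ∏_{i<j} f_{ij}² dx_1 … dx_N`. -/
noncomputable def jastrowNormSq (N : ℕ) (L : ℝ) (f : R3 → ℝ) : ℝ :=
  ∫ x in box N L, jastrowSq N L f x

/-- The potential `V = 2 lam χ_l`, with `χ_l` the characteristic function of the ball
`{|x| ≤ l}`. -/
noncomputable def potential (l lam : ℝ) (x : R3) : ℝ :=
  2 * lam * (Metric.closedBall (0 : R3) l).indicator (fun _ => (1 : ℝ)) x

/-- The two-body term `(N - 1) / 2 * ∫ V_{12} ∏_{i<j} f_{ij}² / ∫ ∏_{i<j} f_{ij}²`; the first two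
particles have the labels `0` and `1`. -/
noncomputable def twoBodyTerm (N : ℕ) [NeZero N] (L l lam : ℝ) (f : R3 → ℝ) : ℝ :=
  ((N : ℝ) - 1) / 2 *
    ((∫ x in box N L, potential l lam (torusRep L (x 0 - x 1)) * jastrowSq N L f x) /
      jastrowNormSq N L f)

/-- The side length `L` of the cube that contains `N` particles at density `N / L³ = rho`. -/
noncomputable def sideLength (rho : ℝ) (N : ℕ) : ℝ := ((N : ℝ) / rho) ^ (1 / 3 : ℝ)

/-- The correlation length `(rho a)^{-1/2} (rho a³)^eps`. -/
noncomputable def corrLength (rho a eps : ℝ) : ℝ :=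
  (rho * a) ^ (-(1 / 2) : ℝ) * (rho * a ^ 3) ^ eps

end HardSphere

/-!
# The two-body energy of a Jastrow state of hard spheres

The weight `∏_{i<j} f_{ij}²` is a classical Gibbs weight with the repulsive pair factor
`φ = f² ≤ 1`, so that the two-body term is a pair expectation in a dilute classical gas. Write
`u = 1 - φ`, `a` for the core radius, `l` for the correlation length.

*The ground state.* The first radial Neumann function is the wave `sin(k (r - a)) / r` up to a
factor, with `tan(k (l - a)) = k l`. A maximum principle for `Δ + lam` on the shell
(`nonpos_of_supersolution`) shows that no smaller eigenvalue admits an eigenfunction equal to `1`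
on the outer sphere, and that `f` is this wave (`IsNeumannGroundState.exists_eq_wave`). Hence
`1 - a / r ≤ f ≤ 1` and `lam ≤ 3 a / (l - a) ^ 3`, so that `∫ V f² ≤ 8πa (1 + O(a / l))`,
`∫ u = O(a l²)` and `∫ u² = O(a² l)`.

*The gas.* Freeze all but the first two particles and let `F(s)` be the interaction `∏_j φ(s - x_j)`
of a test particle at `s` with the others. With `⟨·⟩` the mean in the Gibbs measure of the others,
the pair expectation is the quotient of `∫∫ V(s - t) φ(s - t) ⟨F(s) F(t)⟩` and
`∫∫ φ(s - t) ⟨F(s) F(t)⟩`. By translation invariance and `F(s) F(t) ≤ (F(s)² + F(t)²) / 2` the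
numerator is at most `⟨F²⟩ |Λ| ∫ V φ`; by Cauchy-Schwarz the denominator is at least
`|Λ|² ⟨F⟩² - |Λ| ⟨F²⟩ ∫ u`. Only the variance of `F` is left. The crude bound `⟨1 - F⟩ ≤ rho ∫ u`
would give an error of relative order `(rho a³) ^ (2 eps)`, which is too large for small `eps`; the
variance is really `O(rho ∫ u²)`, and `rho a² l = (rho a l²) (a / l)` is within the allowed error
`a / l = (rho a³) ^ (1/2 - eps)`.

*The variance.* Since `rho ∫ u` is small, moving one particle changes the conditional law of another
one by little, and the Gibbs sampler contracts oscillations (Dobrushin's condition,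
`abs_gibbsSampler_sub_le`). The sampler is self-adjoint, and log-convexity of the norms of its
iterates turns the decay in the supremum norm into a spectral gap, that is, into the Poincaré
inequality `poincare`. For `F`, removing particle `i` changes the value by at most `u(x_i)`,
and the variance bound follows (`IsConvWeight.variance_testWeight_le`).
-/

/-! ### Gibbs weights and their conditional expectations -/

namespace HardSphere

open MeasureTheory Finset Function

/-- Bounded measurable real functions. -/
structure BddMeas {X : Type*} [MeasurableSpace X] (f : X → ℝ) : Prop where
  meas : Measurable f
  bdd : ∃ C, ∀ x, |f x| ≤ C

namespace BddMeas

variable {X Y : Type*} [MeasurableSpace X] [MeasurableSpace Y] {f g : X → ℝ}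

theorem of_mem_Icc (hf : Measurable f) (h0 : ∀ x, 0 ≤ f x) (h1 : ∀ x, f x ≤ 1) : BddMeas f :=
  ⟨hf, 1, fun x => abs_le.2 ⟨by linarith [h0 x], h1 x⟩⟩

theorem const (c : ℝ) : BddMeas (fun _ : X => c) := ⟨measurable_const, |c|, fun _ => le_rfl⟩

theorem mul (hf : BddMeas f) (hg : BddMeas g) : BddMeas (fun x => f x * g x) := by
  obtain ⟨C, hC⟩ := hf.bdd
  obtain ⟨D, hD⟩ := hg.bdd
  refine ⟨hf.meas.mul hg.meas, C * D, fun x => ?_⟩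
  rw [abs_mul]
  exact mul_le_mul (hC x) (hD x) (abs_nonneg _) ((abs_nonneg _).trans (hC x))

theorem add (hf : BddMeas f) (hg : BddMeas g) : BddMeas (fun x => f x + g x) := by
  obtain ⟨C, hC⟩ := hf.bdd
  obtain ⟨D, hD⟩ := hg.bdd
  exact ⟨hf.meas.add hg.meas, C + D, fun x => (abs_add_le _ _).trans (add_le_add (hC x) (hD x))⟩

theorem const_mul (c : ℝ) (hf : BddMeas f) : BddMeas (fun x => c * f x) := (const c).mul hf

theorem sub (hf : BddMeas f) (hg : BddMeas g) : BddMeas (fun x => f x - g x) := by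
  simpa [sub_eq_add_neg] using hf.add (hg.const_mul (-1))

theorem pow (hf : BddMeas f) (n : ℕ) : BddMeas (fun x => f x ^ n) := by
  induction n with
  | zero => simpa using const (X := X) 1
  | succ n ih => simpa [pow_succ] using ih.mul hf

theorem comp (hf : BddMeas f) {h : Y → X} (hh : Measurable h) : BddMeas (fun y => f (h y)) := by
  obtain ⟨C, hC⟩ := hf.bdd
  exact ⟨hf.meas.comp hh, C, fun y => hC _⟩

theorem sum {ι : Type*} (s : Finset ι) {F : ι → X → ℝ} (h : ∀ i ∈ s, BddMeas (F i)) :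
    BddMeas (fun x => ∑ i ∈ s, F i x) := by
  classical
  induction s using Finset.induction_on with
  | empty => simpa using const (X := X) 0
  | insert a s ha ih =>
    simp only [Finset.sum_insert ha]
    exact (h a (by simp)).add (ih fun i hi => h i (by simp [hi]))

theorem prod {ι : Type*} (s : Finset ι) {F : ι → X → ℝ} (h : ∀ i ∈ s, BddMeas (F i)) :
    BddMeas (fun x => ∏ i ∈ s, F i x) := by
  classical
  induction s using Finset.induction_on with
  | empty => simpa using const (X := X) 1
  | insert a s ha ih =>
    simp only [Finset.prod_insert ha]
    exact (h a (by simp)).mul (ih fun i hi => h i (by simp [hi]))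

theorem integrable (hf : BddMeas f) (μ : Measure X) [IsFiniteMeasure μ] : Integrable f μ := by
  obtain ⟨C, hC⟩ := hf.bdd
  exact Integrable.of_bound hf.meas.aestronglyMeasurable C (by simpa using ae_of_all _ hC)

theorem integral_prod_right {F : X × Y → ℝ} (hF : BddMeas F) (ν : Measure Y)
    [IsProbabilityMeasure ν] : BddMeas (fun x => ∫ y, F (x, y) ∂ν) := by
  obtain ⟨C, hC⟩ := hF.bdd
  refine ⟨hF.meas.stronglyMeasurable.integral_prod_right'.measurable, C, fun x => ?_⟩
  simpa using norm_integral_le_of_norm_le_const (μ := ν) (f := fun y => F (x, y)) (C := C)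
    (by simpa using ae_of_all _ fun y => hC (x, y))

end BddMeas

theorem abs_integral_le_of_abs_le {X : Type*} [MeasurableSpace X] {μ : Measure X} {f g : X → ℝ}
    (hg : Integrable g μ) (h : ∀ x, |f x| ≤ g x) : |∫ x, f x ∂μ| ≤ ∫ x, g x ∂μ :=
  norm_integral_le_of_norm_le (f := f) hg (ae_of_all _ h)

/-- Cauchy-Schwarz for a nonnegative weight. -/
theorem sq_integral_mul_le {X : Type*} [MeasurableSpace X] {μ : Measure X} [IsFiniteMeasure μ]
    {f g w : X → ℝ} (hf : BddMeas f) (hg : BddMeas g) (hw : BddMeas w) (h0 : ∀ x, 0 ≤ w x) :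
    (∫ x, f x * g x * w x ∂μ) ^ 2 ≤ (∫ x, f x ^ 2 * w x ∂μ) * ∫ x, g x ^ 2 * w x ∂μ := by
  have key : ∀ t : ℝ, 0 ≤ (∫ x, f x ^ 2 * w x ∂μ) * (t * t) + (2 * ∫ x, f x * g x * w x ∂μ) * t
      + ∫ x, g x ^ 2 * w x ∂μ := by
    intro t
    have h : ∫ x, (t * f x + g x) ^ 2 * w x ∂μ = (∫ x, f x ^ 2 * w x ∂μ) * (t * t)
        + (2 * ∫ x, f x * g x * w x ∂μ) * t + ∫ x, g x ^ 2 * w x ∂μ := by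
      rw [← integral_mul_const, ← integral_const_mul, ← integral_mul_const, ← integral_add,
        ← integral_add]
      · exact integral_congr_ae (ae_of_all _ fun x => by ring)
      · exact ((((hf.pow 2).mul hw).mul (.const (t * t))).add
          ((((hf.mul hg).mul hw).const_mul 2).mul (.const t))).integrable μ
      · exact ((hg.pow 2).mul hw).integrable μ
      · exact (((hf.pow 2).mul hw).mul (.const (t * t))).integrable μ
      · exact ((((hf.mul hg).mul hw).const_mul 2).mul (.const t)).integrable μ
    rw [← h]
    exact integral_nonneg fun x => mul_nonneg (sq_nonneg _) (h0 x)
  have := discrim_le_zero key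
  unfold discrim at this
  nlinarith

/-- The union bound `∏ a_i ≥ 1 - ∑ (1 - a_i)` for `a_i ∈ [0, 1]`. -/
theorem one_sub_sum_le_prod {ι : Type*} (s : Finset ι) (a : ι → ℝ) (h0 : ∀ i, 0 ≤ a i)
    (h1 : ∀ i, a i ≤ 1) : 1 - ∑ i ∈ s, (1 - a i) ≤ ∏ i ∈ s, a i := by
  classical
  induction s using Finset.induction_on with
  | empty => simp
  | insert i s hi ih =>
    rw [Finset.sum_insert hi, Finset.prod_insert hi]
    have : ∏ j ∈ s, a j ≤ 1 := Finset.prod_le_one (fun j _ => h0 j) fun j _ => h1 j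
    nlinarith [h0 i, h1 i]

/-- A symmetric measurable pair weight with values in `[0, 1]` that differs from `1` little on
average: `∫ (1 - κ(z, x)) dν(z) ≤ p` for all `x`. -/
structure IsPairWeight {T : Type*} [MeasurableSpace T] (ν : Measure T) (κ : T → T → ℝ) (p : ℝ) :
    Prop where
  meas : Measurable (uncurry κ)
  symm : ∀ x y, κ x y = κ y x
  nonneg : ∀ x y, 0 ≤ κ x y
  le_one : ∀ x y, κ x y ≤ 1
  defect : ∀ x, ∫ z, (1 - κ z x) ∂ν ≤ p

section Gibbs

variable {T : Type*} [MeasurableSpace T] {n : ℕ}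

/-- The Gibbs weight `∏_{i<j} κ(x_i, x_j)`. -/
noncomputable def gibbsWeight (κ : T → T → ℝ) (x : Fin n → T) : ℝ :=
  ∏ i : Fin n, ∏ j ∈ Finset.Ioi i, κ (x i) (x j)

/-- Integration of `f` over the `i`-th coordinate. -/
noncomputable def siteIntegral (ν : Measure T) (i : Fin n) (f : (Fin n → T) → ℝ)
    (x : Fin n → T) : ℝ :=
  ∫ z, f (update x i z) ∂ν

/-- The interaction of the `i`-th particle with all others. -/
noncomputable def siteWeight (κ : T → T → ℝ) (i : Fin n) (x : Fin n → T) : ℝ :=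
  ∏ k ∈ univ.erase i, κ (x i) (x k)

/-- The conditional expectation of `f` under the Gibbs measure, given all coordinates but the
`i`-th. The conditional density is defined at every configuration, not only at those of positive
weight. -/
noncomputable def heatBath (ν : Measure T) (κ : T → T → ℝ) (i : Fin n) (f : (Fin n → T) → ℝ)
    (x : Fin n → T) : ℝ :=
  siteIntegral ν i (fun y => f y * siteWeight κ i y) x / siteIntegral ν i (siteWeight κ i) x

/-- The transition operator of the random-scan Gibbs sampler. -/
noncomputable def gibbsSampler (ν : Measure T) (κ : T → T → ℝ) (f : (Fin n → T) → ℝ)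
    (x : Fin n → T) : ℝ :=
  (n : ℝ)⁻¹ * ∑ i, heatBath ν κ i f x

variable {ν : Measure T} {κ : T → T → ℝ} {p : ℝ}

/-- Resampling one coordinate preserves the product measure. -/
theorem measurePreserving_update (ν : Measure T) [IsProbabilityMeasure ν] (i : Fin n) :
    MeasurePreserving (fun q : (Fin n → T) × T => update q.1 i q.2)
      ((Measure.pi fun _ => ν).prod ν) (Measure.pi fun _ => ν) := by
  refine ⟨measurable_update', ?_⟩
  symm
  refine Measure.pi_eq fun s hs => ?_
  rw [Measure.map_apply measurable_update' (MeasurableSet.univ_pi hs)]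
  have : (fun q : (Fin n → T) × T => update q.1 i q.2) ⁻¹' (Set.univ.pi s) =
      (Set.univ.pi (update s i Set.univ)) ×ˢ (s i) := by
    ext ⟨x, z⟩
    simp only [Set.mem_preimage, Set.mem_pi, Set.mem_univ, true_imp_iff, Set.mem_prod]
    constructor
    · intro h
      refine ⟨fun k => ?_, by simpa using h i⟩
      rcases eq_or_ne k i with rfl | hk
      · simp
      · simpa [hk] using h k
    · rintro ⟨h, h'⟩ k
      rcases eq_or_ne k i with rfl | hk
      · simpa using h'
      · simpa [hk] using h k
  rw [this, Measure.prod_prod, Measure.pi_pi, ← Finset.prod_erase_mul _ _ (mem_univ i),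
    ← Finset.prod_erase_mul (a := i) univ (fun k => ν (s k)) (mem_univ i)]
  simp only [update_self, measure_univ, mul_one]
  congr 1
  refine Finset.prod_congr rfl fun k hk => ?_
  rw [update_of_ne (Finset.ne_of_mem_erase hk)]

theorem BddMeas.siteIntegral [IsProbabilityMeasure ν] {f : (Fin n → T) → ℝ} (hf : BddMeas f)
    (i : Fin n) :
    BddMeas (siteIntegral ν i f) :=
  BddMeas.integral_prod_right (F := fun q : (Fin n → T) × T => f (update q.1 i q.2))
    (hf.comp measurable_update') ν

theorem integral_siteIntegral [IsProbabilityMeasure ν] {f : (Fin n → T) → ℝ} (hf : BddMeas f)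
    (i : Fin n) :
    ∫ x, siteIntegral ν i f x ∂(Measure.pi fun _ => ν) = ∫ x, f x ∂(Measure.pi fun _ => ν) := by
  have h := measurePreserving_update (n := n) ν i
  rw [← h.map_eq, integral_map h.measurable.aemeasurable
    hf.meas.stronglyMeasurable.aestronglyMeasurable, integral_prod _
    ((hf.comp measurable_update').integrable _)]
  simp only [h.map_eq, HardSphere.siteIntegral]

theorem siteIntegral_update (i : Fin n) (f : (Fin n → T) → ℝ) (x : Fin n → T) (z : T) :
    siteIntegral ν i f (update x i z) = siteIntegral ν i f x := by
  simp [siteIntegral]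

theorem heatBath_update (i : Fin n) (f : (Fin n → T) → ℝ) (x : Fin n → T) (z : T) :
    heatBath ν κ i f (update x i z) = heatBath ν κ i f x := by
  simp [heatBath, siteIntegral_update]

theorem siteIntegral_mul_right (i : Fin n) (f g : (Fin n → T) → ℝ)
    (hg : ∀ x z, g (update x i z) = g x) (x : Fin n → T) :
    siteIntegral ν i (fun y => f y * g y) x = siteIntegral ν i f x * g x := by
  simp only [siteIntegral, hg]
  exact integral_mul_const _ _

theorem IsPairWeight.bddMeas (hκ : IsPairWeight ν κ p) {X : Type*} [MeasurableSpace X]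
    {a b : X → T} (ha : Measurable a) (hb : Measurable b) :
    BddMeas (fun x => κ (a x) (b x)) :=
  .of_mem_Icc (hκ.meas.comp (ha.prodMk hb)) (fun _ => hκ.nonneg _ _) fun _ => hκ.le_one _ _

theorem IsPairWeight.bddMeas_gibbsWeight (hκ : IsPairWeight ν κ p) :
    BddMeas (gibbsWeight (n := n) κ) :=
  .prod _ fun i _ => .prod _ fun j _ => hκ.bddMeas (measurable_pi_apply i) (measurable_pi_apply j)

theorem IsPairWeight.gibbsWeight_nonneg (hκ : IsPairWeight ν κ p) (x : Fin n → T) :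
    0 ≤ gibbsWeight κ x :=
  Finset.prod_nonneg fun _ _ => Finset.prod_nonneg fun _ _ => hκ.nonneg _ _

theorem IsPairWeight.bddMeas_siteWeight (hκ : IsPairWeight ν κ p) (i : Fin n) :
    BddMeas (siteWeight κ i) :=
  .prod _ fun j _ => hκ.bddMeas (measurable_pi_apply i) (measurable_pi_apply j)

theorem IsPairWeight.siteWeight_nonneg (hκ : IsPairWeight ν κ p) (i : Fin n) (x : Fin n → T) :
    0 ≤ siteWeight κ i x :=
  Finset.prod_nonneg fun _ _ => hκ.nonneg _ _

theorem IsPairWeight.siteWeight_le_one (hκ : IsPairWeight ν κ p) (i : Fin n) (x : Fin n → T) :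
    siteWeight κ i x ≤ 1 :=
  Finset.prod_le_one (fun _ _ => hκ.nonneg _ _) fun _ _ => hκ.le_one _ _

theorem siteWeight_update {T : Type*} {κ : T → T → ℝ} (i : Fin n) (x : Fin n → T) (z : T) :
    siteWeight κ i (update x i z) = ∏ k ∈ univ.erase i, κ z (x k) := by
  unfold siteWeight
  refine Finset.prod_congr rfl fun k hk => ?_
  rw [update_self, update_of_ne (Finset.ne_of_mem_erase hk)]

theorem IsPairWeight.defect_nonneg [IsProbabilityMeasure ν] (hκ : IsPairWeight ν κ p) : 0 ≤ p := by
  obtain ⟨x⟩ : Nonempty T := nonempty_of_isProbabilityMeasure ν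
  exact (integral_nonneg fun z => sub_nonneg.2 (hκ.le_one z x)).trans (hκ.defect x)

/-- The average over a test particle `z` of its interaction with finitely many given particles is
at least `1 - (number of particles) * p`. -/
theorem IsPairWeight.one_sub_le_integral_prod [IsProbabilityMeasure ν]
    (hκ : IsPairWeight ν κ p) {ι : Type*} (s : Finset ι) (x : ι → T) :
    1 - s.card * p ≤ ∫ z, ∏ k ∈ s, κ z (x k) ∂ν := by
  have hb : ∀ k, BddMeas (fun z => 1 - κ z (x k)) := fun k =>
    (BddMeas.const 1).sub (hκ.bddMeas measurable_id measurable_const)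
  have hp : BddMeas (fun z => ∏ k ∈ s, κ z (x k)) :=
    .prod _ fun k _ => hκ.bddMeas measurable_id measurable_const
  calc 1 - s.card * p ≤ 1 - ∑ k ∈ s, ∫ z, (1 - κ z (x k)) ∂ν := by
        have : ∑ k ∈ s, ∫ z, (1 - κ z (x k)) ∂ν ≤ ∑ _k ∈ s, p :=
          Finset.sum_le_sum fun k _ => hκ.defect _
        rw [Finset.sum_const, nsmul_eq_mul] at this
        linarith
    _ = ∫ z, (1 - ∑ k ∈ s, (1 - κ z (x k))) ∂ν := by
        rw [integral_sub (integrable_const _) ((BddMeas.sum s fun k _ => hb k).integrable ν),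
          integral_finsetSum _ fun k _ => (hb k).integrable ν]
        simp
    _ ≤ _ := integral_mono ((BddMeas.const 1).sub (.sum s fun k _ => hb k) |>.integrable ν)
        (hp.integrable ν) fun z => one_sub_sum_le_prod s _ (fun k => hκ.nonneg _ _)
          fun k => hκ.le_one _ _

theorem IsPairWeight.le_siteIntegral_siteWeight [IsProbabilityMeasure ν]
    (hκ : IsPairWeight ν κ p) (i : Fin n) (x : Fin n → T) :
    1 - n * p ≤ siteIntegral ν i (siteWeight κ i) x := by
  have h := hκ.one_sub_le_integral_prod (univ.erase i) x
  simp only [siteIntegral, siteWeight_update]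
  refine le_trans ?_ h
  have : ((univ.erase i).card : ℝ) ≤ n := by
    exact_mod_cast (card_le_univ _).trans (by simp)
  nlinarith [hκ.defect_nonneg]

/-- The Gibbs weight is the interaction of particle `i` times a factor that does not see it. -/
theorem exists_gibbsWeight_eq (hκ : IsPairWeight ν κ p) (i : Fin n) :
    ∃ R : (Fin n → T) → ℝ, BddMeas R ∧ (∀ x, 0 ≤ R x) ∧ (∀ x z, R (update x i z) = R x) ∧
      ∀ x, gibbsWeight κ x = siteWeight κ i x * R x := by
  refine ⟨fun x => ∏ a : Fin n, ∏ b ∈ Finset.Ioi a,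
    if a = i ∨ b = i then 1 else κ (x a) (x b), ?_, ?_, ?_, ?_⟩
  · refine .prod _ fun a _ => .prod _ fun b _ => ?_
    by_cases h : a = i ∨ b = i
    · simpa [h] using BddMeas.const 1
    · simpa [h] using hκ.bddMeas (measurable_pi_apply a) (measurable_pi_apply b)
  · refine fun x => Finset.prod_nonneg fun a _ => Finset.prod_nonneg fun b _ => ?_
    split_ifs
    · exact zero_le_one
    · exact hκ.nonneg _ _
  · refine fun x z => Finset.prod_congr rfl fun a _ => Finset.prod_congr rfl fun b _ => ?_
    split_ifs with h
    · rfl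
    · push Not at h
      rw [update_of_ne h.1, update_of_ne h.2]
  · intro x
    have hsplit : siteWeight κ i x = ∏ a : Fin n, ∏ b ∈ Finset.Ioi a,
        if a = i ∨ b = i then κ (x a) (x b) else 1 := by
      have hrow : ∀ a, (∏ b ∈ Finset.Ioi a, if a = i ∨ b = i then κ (x a) (x b) else 1) =
          (if a = i then ∏ b ∈ Finset.Ioi i, κ (x i) (x b) else 1) *
            (if a < i then κ (x i) (x a) else 1) := by
        intro a
        rcases eq_or_ne a i with rfl | ha
        · simp
        · simp only [ha, false_or, if_false, one_mul]
          rw [Finset.prod_ite_eq' (Finset.Ioi a) i (fun b => κ (x a) (x b))]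
          simp [hκ.symm (x a) (x i)]
      simp_rw [hrow]
      rw [Finset.prod_mul_distrib, Finset.prod_ite_eq' univ i, if_pos (mem_univ _),
        ← Finset.prod_filter, siteWeight]
      have : univ.erase i = Finset.Ioi i ∪ univ.filter (· < i) := by
        ext k; simp [lt_or_lt_iff_ne, eq_comm]
      rw [this, Finset.prod_union]
      rw [Finset.disjoint_left]
      intro k hk hk'
      simp at hk hk'
      exact absurd hk (not_lt.2 hk'.le)
    rw [hsplit, gibbsWeight, ← Finset.prod_mul_distrib]
    refine Finset.prod_congr rfl fun a _ => ?_
    rw [← Finset.prod_mul_distrib]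
    refine Finset.prod_congr rfl fun b _ => ?_
    split_ifs <;> simp

end Gibbs

end HardSphere

/-! ### The Poincaré inequality under Dobrushin's condition -/

namespace HardSphere

open MeasureTheory Finset Function

section Gibbs

variable {T : Type*} [MeasurableSpace T] {n : ℕ}
variable {ν : Measure T} [IsProbabilityMeasure ν] {κ : T → T → ℝ} {p : ℝ}

theorem IsPairWeight.siteIntegral_siteWeight_pos (hκ : IsPairWeight ν κ p) (hnp : 9 * (n * p) ≤ 1)
    (i : Fin n) (x : Fin n → T) : 0 < siteIntegral ν i (siteWeight κ i) x := by
  linarith [hκ.le_siteIntegral_siteWeight i x]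

theorem BddMeas.heatBath (hκ : IsPairWeight ν κ p) (hnp : 9 * (n * p) ≤ 1) {f : (Fin n → T) → ℝ}
    (hf : BddMeas f) (i : Fin n) : BddMeas (heatBath ν κ i f) := by
  have hw := (hκ.bddMeas_siteWeight i).siteIntegral (ν := ν) i
  have hinv : BddMeas (fun x => (HardSphere.siteIntegral ν i (siteWeight κ i) x)⁻¹) := by
    refine ⟨hw.meas.inv, 2, fun x => ?_⟩
    have h := hκ.le_siteIntegral_siteWeight i x
    rw [abs_of_nonneg (inv_nonneg.2 (by linarith))]
    exact inv_le_of_inv_le₀ two_pos (by linarith)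
  exact ((hf.mul (hκ.bddMeas_siteWeight i)).siteIntegral (ν := ν) i).mul hinv

theorem BddMeas.gibbsSampler (hκ : IsPairWeight ν κ p) (hnp : 9 * (n * p) ≤ 1)
    {f : (Fin n → T) → ℝ} (hf : BddMeas f) : BddMeas (gibbsSampler ν κ f) :=
  (BddMeas.sum _ fun i _ => hf.heatBath hκ hnp i).const_mul _

/-- The quadratic form of the conditional expectation, in a form symmetric in `f` and `g`. -/
theorem integral_mul_heatBath (hκ : IsPairWeight ν κ p) (hnp : 9 * (n * p) ≤ 1)
    {f g R : (Fin n → T) → ℝ} (hf : BddMeas f) (hg : BddMeas g) (i : Fin n) (hR : BddMeas R)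
    (hRi : ∀ x z, R (update x i z) = R x) (hW : ∀ x, gibbsWeight κ x = siteWeight κ i x * R x) :
    ∫ x, g x * heatBath ν κ i f x * gibbsWeight κ x ∂(Measure.pi fun _ => ν) =
      ∫ x, siteIntegral ν i (fun y => g y * siteWeight κ i y) x *
        siteIntegral ν i (fun y => f y * siteWeight κ i y) x /
        siteIntegral ν i (siteWeight κ i) x * R x ∂(Measure.pi fun _ => ν) := by
  have hG := (hf.heatBath hκ hnp i).mul hR
  calc _ = ∫ x, (g x * siteWeight κ i x) * (heatBath ν κ i f x * R x)
        ∂(Measure.pi fun _ => ν) := by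
        refine integral_congr_ae (ae_of_all _ fun x => ?_)
        simp only [hW]; ring
    _ = ∫ x, siteIntegral ν i (fun x => (g x * siteWeight κ i x) *
          (heatBath ν κ i f x * R x)) x ∂(Measure.pi fun _ => ν) :=
        (integral_siteIntegral ((hg.mul (hκ.bddMeas_siteWeight i)).mul hG) i).symm
    _ = _ := by
        refine integral_congr_ae (ae_of_all _ fun x => ?_)
        simp only
        rw [siteIntegral_mul_right i (fun x => g x * siteWeight κ i x)
          (fun x => heatBath ν κ i f x * R x) fun x z => by rw [heatBath_update, hRi]]
        simp only [heatBath]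
        ring

theorem integral_mul_heatBath_comm (hκ : IsPairWeight ν κ p) (hnp : 9 * (n * p) ≤ 1)
    {f g : (Fin n → T) → ℝ} (hf : BddMeas f) (hg : BddMeas g) (i : Fin n) :
    ∫ x, g x * heatBath ν κ i f x * gibbsWeight κ x ∂(Measure.pi fun _ => ν) =
      ∫ x, f x * heatBath ν κ i g x * gibbsWeight κ x ∂(Measure.pi fun _ => ν) := by
  obtain ⟨R, hR, -, hRi, hW⟩ := exists_gibbsWeight_eq (n := n) hκ i
  rw [integral_mul_heatBath hκ hnp hf hg i hR hRi hW,
    integral_mul_heatBath hκ hnp hg hf i hR hRi hW]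
  refine integral_congr_ae (ae_of_all _ fun x => ?_)
  simp only
  ring

theorem integral_mul_heatBath_self_nonneg (hκ : IsPairWeight ν κ p) (hnp : 9 * (n * p) ≤ 1)
    {f : (Fin n → T) → ℝ} (hf : BddMeas f) (i : Fin n) :
    0 ≤ ∫ x, f x * heatBath ν κ i f x * gibbsWeight κ x ∂(Measure.pi fun _ => ν) := by
  obtain ⟨R, hR, hR0, hRi, hW⟩ := exists_gibbsWeight_eq (n := n) hκ i
  rw [integral_mul_heatBath hκ hnp hf hf i hR hRi hW]
  exact integral_nonneg fun x => mul_nonneg (div_nonneg (mul_self_nonneg _)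
    (hκ.siteIntegral_siteWeight_pos hnp i x).le) (hR0 x)

theorem heatBath_eq_self (hκ : IsPairWeight ν κ p) (hnp : 9 * (n * p) ≤ 1)
    {g : (Fin n → T) → ℝ} (i : Fin n) (hgi : ∀ x z, g (update x i z) = g x) (x : Fin n → T) :
    heatBath ν κ i g x = g x := by
  have h := siteIntegral_mul_right (ν := ν) i (siteWeight κ i) g hgi x
  simp only [heatBath, mul_comm (g _)]
  rw [h, mul_div_cancel_left₀ _ (hκ.siteIntegral_siteWeight_pos hnp i x).ne']

theorem heatBath_sub (hκ : IsPairWeight ν κ p) {f g : (Fin n → T) → ℝ} (hf : BddMeas f)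
    (hg : BddMeas g) (i : Fin n) (x : Fin n → T) :
    heatBath ν κ i (fun y => f y - g y) x = heatBath ν κ i f x - heatBath ν κ i g x := by
  have hw := hκ.bddMeas_siteWeight i
  have hu : Measurable (fun z => update x i z) := measurable_update x
  simp only [heatBath, siteIntegral, sub_mul]
  rw [integral_sub (((hf.mul hw).comp hu).integrable ν) (((hg.mul hw).comp hu).integrable ν),
    sub_div]

/-- The conditional variance given all coordinates but the `i`-th is at most the mean square
distance to any function of these coordinates. -/
theorem integral_mul_sub_heatBath_le (hκ : IsPairWeight ν κ p) (hnp : 9 * (n * p) ≤ 1)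
    {f g : (Fin n → T) → ℝ} (hf : BddMeas f) (hg : BddMeas g) (i : Fin n)
    (hgi : ∀ x z, g (update x i z) = g x) :
    ∫ x, f x * (f x - heatBath ν κ i f x) * gibbsWeight κ x ∂(Measure.pi fun _ => ν) ≤
      ∫ x, (f x - g x) ^ 2 * gibbsWeight κ x ∂(Measure.pi fun _ => ν) := by
  have hW := hκ.bddMeas_gibbsWeight (n := n)
  have hP := hf.heatBath hκ hnp i
  have h0 := integral_mul_heatBath_self_nonneg hκ hnp (hf.sub hg) i
  have h1 := integral_mul_heatBath_comm hκ hnp hf hg i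
  simp only [heatBath_sub hκ hf hg, heatBath_eq_self hκ hnp i hgi] at h0 h1
  have h2 : ∫ x, (f x - g x) ^ 2 * gibbsWeight κ x ∂(Measure.pi fun _ => ν) -
      ∫ x, (f x - g x) * (heatBath ν κ i f x - g x) * gibbsWeight κ x ∂(Measure.pi fun _ => ν) =
      ∫ x, f x * (f x - heatBath ν κ i f x) * gibbsWeight κ x ∂(Measure.pi fun _ => ν) +
      (∫ x, g x * heatBath ν κ i f x * gibbsWeight κ x ∂(Measure.pi fun _ => ν) -
      ∫ x, f x * g x * gibbsWeight κ x ∂(Measure.pi fun _ => ν)) := by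
    rw [← integral_sub ((((hf.sub hg).pow 2).mul hW).integrable _)
        ((((hf.sub hg).mul (hP.sub hg)).mul hW).integrable _),
      ← integral_sub (((hg.mul hP).mul hW).integrable _) (((hf.mul hg).mul hW).integrable _),
      ← integral_add (((hf.mul (hf.sub hP)).mul hW).integrable _)
        ((((hg.mul hP).mul hW).sub ((hf.mul hg).mul hW)).integrable _)]
    exact integral_congr_ae (ae_of_all _ fun x => by ring)
  linarith

/-- Two weighted averages, of functions `a`, `a'` that differ by at most `M`, where `a'` also has
oscillation at most `M`, differ by `M` plus a multiple of the distance of the weights. -/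
theorem abs_sub_weighted_average_le {a a' w w' : T → ℝ} {M e N₀ : ℝ} (ha : BddMeas a)
    (ha' : BddMeas a') (hw : BddMeas w) (hw' : BddMeas w') (w0 : ∀ t, 0 ≤ w t)
    (w0' : ∀ t, 0 ≤ w' t) (hN₀ : 0 < N₀) (hN : N₀ ≤ ∫ t, w t ∂ν) (hN' : 0 < ∫ t, w' t ∂ν)
    (hd : ∀ t, |a t - a' t| ≤ M) (hosc : ∀ s t, |a' s - a' t| ≤ M)
    (he : ∫ t, |w t - w' t| ∂ν ≤ e) :
    |(∫ t, a t * w t ∂ν) / (∫ t, w t ∂ν) - (∫ t, a' t * w' t ∂ν) / ∫ t, w' t ∂ν| ≤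
      M * (1 + 2 * e / N₀) := by
  obtain ⟨t₀⟩ : Nonempty T := nonempty_of_isProbabilityMeasure ν
  have hM : 0 ≤ M := (abs_nonneg _).trans (hd t₀)
  set c := a' t₀
  set N := ∫ t, w t ∂ν
  set N' := ∫ t, w' t ∂ν
  have hNp : 0 < N := hN₀.trans_le hN
  have hb : BddMeas (fun t => a' t - c) := ha'.sub (.const c)
  have e1 : ∫ t, a t * w t ∂ν = ∫ t, (a t - a' t) * w t ∂ν + ∫ t, (a' t - c) * (w t - w' t) ∂ν +
      ∫ t, (a' t - c) * w' t ∂ν + c * N := by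
    rw [← integral_const_mul, ← integral_add (((ha.sub ha').mul hw).integrable ν)
      ((hb.mul (hw.sub hw')).integrable ν), ← integral_add
      ((((ha.sub ha').mul hw).add (hb.mul (hw.sub hw'))).integrable ν)
      ((hb.mul hw').integrable ν), ← integral_add
      (((((ha.sub ha').mul hw).add (hb.mul (hw.sub hw'))).add (hb.mul hw')).integrable ν)
      ((hw.const_mul c).integrable ν)]
    exact integral_congr_ae (ae_of_all _ fun x => by ring)
  have e2 : ∫ t, a' t * w' t ∂ν = ∫ t, (a' t - c) * w' t ∂ν + c * N' := by
    rw [← integral_const_mul, ← integral_add ((hb.mul hw').integrable ν)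
      ((hw'.const_mul c).integrable ν)]
    exact integral_congr_ae (ae_of_all _ fun x => by ring)
  have b1 : |∫ t, (a t - a' t) * w t ∂ν| ≤ M * N := by
    rw [← integral_const_mul]
    refine abs_integral_le_of_abs_le ((hw.const_mul M).integrable ν) fun t => ?_
    rw [abs_mul, abs_of_nonneg (w0 t)]
    exact mul_le_mul_of_nonneg_right (hd t) (w0 t)
  have hwabs : Integrable (fun t => |w t - w' t|) ν := ((hw.sub hw').integrable ν).abs
  have b2 : |∫ t, (a' t - c) * (w t - w' t) ∂ν| ≤ M * e := by
    refine le_trans ?_ (mul_le_mul_of_nonneg_left he hM)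
    rw [← integral_const_mul]
    refine abs_integral_le_of_abs_le (hwabs.const_mul M) fun t => ?_
    rw [abs_mul]
    exact mul_le_mul_of_nonneg_right (hosc t t₀) (abs_nonneg _)
  have b3 : |∫ t, (a' t - c) * w' t ∂ν| ≤ M * N' := by
    rw [← integral_const_mul]
    refine abs_integral_le_of_abs_le ((hw'.const_mul M).integrable ν) fun t => ?_
    rw [abs_mul, abs_of_nonneg (w0' t)]
    exact mul_le_mul_of_nonneg_right (hosc t t₀) (w0' t)
  have b4 : |N' - N| ≤ e := by
    have : N' - N = -∫ t, (w t - w' t) ∂ν := by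
      rw [integral_sub (hw.integrable ν) (hw'.integrable ν)]; ring
    rw [this, abs_neg]
    exact (abs_integral_le_integral_abs).trans he
  rw [e1, e2]
  set I1 := ∫ t, (a t - a' t) * w t ∂ν
  set I2 := ∫ t, (a' t - c) * (w t - w' t) ∂ν
  set I3 := ∫ t, (a' t - c) * w' t ∂ν
  have e3 : (I1 + I2 + I3 + c * N) / N - (I3 + c * N') / N' =
      I1 / N + I2 / N + I3 / N' * ((N' - N) / N) := by
    field_simp
    ring
  have e0 : 0 ≤ e := (abs_nonneg _).trans b4
  have c1 : |I1 / N| ≤ M := by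
    rw [abs_div, abs_of_pos hNp]; exact div_le_of_le_mul₀ hNp.le hM b1
  have c2 : |I2 / N| ≤ M * (e / N₀) := by
    rw [abs_div, abs_of_pos hNp, ← mul_div_assoc]
    exact div_le_div₀ (by positivity) b2 hN₀ hN
  have c3 : |I3 / N' * ((N' - N) / N)| ≤ M * (e / N₀) := by
    rw [abs_mul]
    refine mul_le_mul ?_ ?_ (abs_nonneg _) hM
    · rw [abs_div, abs_of_pos hN']; exact div_le_of_le_mul₀ hN'.le hM b3
    · rw [abs_div, abs_of_pos hNp]; exact div_le_div₀ e0 b4 hN₀ hN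
  rw [e3]
  calc _ ≤ |I1 / N| + |I2 / N| + |I3 / N' * ((N' - N) / N)| := abs_add_three _ _ _
    _ ≤ M + M * (e / N₀) + M * (e / N₀) := by linarith
    _ = _ := by ring

/-- Dobrushin's estimate: moving the particle `j` changes the conditional law of particle `i` by
`O(p)` in total variation. -/
theorem abs_heatBath_sub_heatBath_update_le (hκ : IsPairWeight ν κ p) (hnp : 9 * (n * p) ≤ 1)
    {f : (Fin n → T) → ℝ} (hf : BddMeas f) {M : ℝ}
    (hM : ∀ x j z, |f x - f (update x j z)| ≤ M) (i j : Fin n) (hij : i ≠ j) (x : Fin n → T)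
    (z : T) :
    |heatBath ν κ i f x - heatBath ν κ i f (update x j z)| ≤ M * (1 + 9 / 2 * p) := by
  have hp := hκ.defect_nonneg
  have hw : ∀ y : Fin n → T, BddMeas (fun t => siteWeight κ i (update y i t)) :=
    fun y => (hκ.bddMeas_siteWeight i).comp (measurable_update y)
  have ha : ∀ y : Fin n → T, BddMeas (fun t => f (update y i t)) :=
    fun y => hf.comp (measurable_update y)
  have hN := hκ.le_siteIntegral_siteWeight (n := n) i
  have key := abs_sub_weighted_average_le (ν := ν) (M := M) (e := 2 * p) (N₀ := 8 / 9)
    (ha x) (ha (update x j z)) (hw x) (hw (update x j z)) (fun t => hκ.siteWeight_nonneg i _)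
    (fun t => hκ.siteWeight_nonneg i _) (by norm_num) (le_trans (by linarith) (hN x))
    (hκ.siteIntegral_siteWeight_pos hnp i (update x j z)) ?_ ?_ ?_
  · simp only [heatBath, siteIntegral]
    refine key.trans (le_of_eq ?_)
    ring
  · intro t
    rw [update_comm hij.symm]
    exact hM _ _ _
  · intro s t
    have := hM (update (update x j z) i s) i t
    rwa [update_idem] at this
  · have hd : ∀ y : T, BddMeas (fun t => 1 - κ t y) := fun y =>
      (BddMeas.const 1).sub (hκ.bddMeas measurable_id measurable_const)
    calc ∫ t, |siteWeight κ i (update x i t) - siteWeight κ i (update (update x j z) i t)| ∂ν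
        ≤ ∫ t, ((1 - κ t (x j)) + (1 - κ t z)) ∂ν := by
          refine integral_mono (((hw x).sub (hw _)).integrable ν).abs
            (((hd _).add (hd _)).integrable ν) fun t => ?_
          have hj : j ∈ univ.erase i := mem_erase.2 ⟨hij.symm, mem_univ _⟩
          simp only [siteWeight_update]
          rw [← Finset.mul_prod_erase _ _ hj, ← Finset.mul_prod_erase _ _ hj, update_self]
          have hsame : ∏ k ∈ (univ.erase i).erase j, κ t (update x j z k) =
              ∏ k ∈ (univ.erase i).erase j, κ t (x k) :=
            Finset.prod_congr rfl fun k hk => by rw [update_of_ne (ne_of_mem_erase hk)]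
          rw [hsame, ← sub_mul, abs_mul]
          set h := ∏ k ∈ (univ.erase i).erase j, κ t (x k)
          have h0 : 0 ≤ h := Finset.prod_nonneg fun _ _ => hκ.nonneg _ _
          have h1 : h ≤ 1 := Finset.prod_le_one (fun _ _ => hκ.nonneg _ _) fun _ _ => hκ.le_one _ _
          rw [abs_of_nonneg h0]
          have : |κ t (x j) - κ t z| ≤ (1 - κ t (x j)) + (1 - κ t z) :=
            abs_le.2 ⟨by linarith [hκ.le_one t (x j), hκ.le_one t z],
              by linarith [hκ.le_one t (x j), hκ.le_one t z]⟩
          nlinarith [abs_nonneg (κ t (x j) - κ t z)]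
      _ ≤ 2 * p := by
          rw [integral_add ((hd _).integrable ν) ((hd _).integrable ν)]
          linarith [hκ.defect (x j), hκ.defect z]

/-- The Gibbs sampler contracts the maximal one-coordinate oscillation. -/
theorem abs_gibbsSampler_sub_le (hκ : IsPairWeight ν κ p) (hnp : 9 * (n * p) ≤ 1)
    {f : (Fin n → T) → ℝ} (hf : BddMeas f) {M : ℝ}
    (hM : ∀ x j z, |f x - f (update x j z)| ≤ M) (x : Fin n → T) (j : Fin n) (z : T) :
    |gibbsSampler ν κ f x - gibbsSampler ν κ f (update x j z)| ≤ (1 - 1 / (2 * n)) * M := by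
  have hn : (0 : ℝ) < n := by exact_mod_cast j.pos
  have hM0 : 0 ≤ M := (abs_nonneg _).trans (hM x j z)
  have hp := hκ.defect_nonneg
  simp only [gibbsSampler]
  rw [← mul_sub, ← Finset.sum_sub_distrib, abs_mul, abs_of_pos (inv_pos.2 hn)]
  have hterm : ∀ i ∈ univ.erase j, |heatBath ν κ i f x - heatBath ν κ i f (update x j z)| ≤
      M * (1 + 9 / 2 * p) := fun i hi =>
    abs_heatBath_sub_heatBath_update_le hκ hnp hf hM i j (ne_of_mem_erase hi) x z
  have hsum : |∑ i, (heatBath ν κ i f x - heatBath ν κ i f (update x j z))| ≤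
      (n - 1) * (M * (1 + 9 / 2 * p)) := by
    rw [← Finset.sum_erase_add _ _ (mem_univ j), heatBath_update, sub_self, add_zero]
    refine (Finset.abs_sum_le_sum_abs _ _).trans ((Finset.sum_le_sum hterm).trans (le_of_eq ?_))
    rw [Finset.sum_const, card_erase_of_mem (mem_univ j), nsmul_eq_mul, card_univ,
      Fintype.card_fin, Nat.cast_sub j.pos, Nat.cast_one]
  calc _ ≤ (n : ℝ)⁻¹ * ((n - 1) * (M * (1 + 9 / 2 * p))) := by gcongr
    _ = (n : ℝ)⁻¹ * (M * ((n - 1) * (1 + 9 / 2 * p))) := by ring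
    _ ≤ (n : ℝ)⁻¹ * (M * (n - 1 / 2)) := by
        gcongr
        nlinarith
    _ = _ := by field_simp

/-- Changing the coordinates one by one, the oscillation is at most `n` times the maximal
one-coordinate oscillation. -/
theorem abs_sub_le_of_update {T : Type*} {f : (Fin n → T) → ℝ} {M : ℝ}
    (hM : ∀ x j z, |f x - f (update x j z)| ≤ M) (x y : Fin n → T) : |f x - f y| ≤ n * M := by
  have key : ∀ s : Finset (Fin n), |f x - f (s.piecewise y x)| ≤ s.card * M := by
    intro s
    induction s using Finset.induction_on with
    | empty => simp
    | insert i s hi ih =>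
      rw [Finset.piecewise_insert, card_insert_of_notMem hi]
      push_cast
      have := hM (s.piecewise y x) i (y i)
      calc _ ≤ _ := abs_sub_le _ (f (s.piecewise y x)) _
        _ ≤ _ := by linarith
  simpa using key univ

/-- If the squares `b m` of the norms of iterates are log-convex and decay at rate `r ^ (2 m)`,
then the very first step already contracts by `r ^ 2`. -/
theorem le_mul_of_logConvex {b : ℕ → ℝ} {s C : ℝ} (hs : 0 < s) (hb : ∀ m, 0 ≤ b m)
    (hlog : ∀ m, b (m + 1) ^ 2 ≤ b m * b (m + 2)) (hdecay : ∀ m, b m ≤ C * s ^ m) :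
    b 1 ≤ s * b 0 := by
  by_contra! hlt
  have h0 : 0 < b 0 := by
    rcases (hb 0).eq_or_lt with h | h
    · have := hlog 0
      rw [← h] at this hlt
      nlinarith
    · exact h
  set q := b 1 / b 0 with hq
  have hsq : s < q := by rwa [hq, lt_div_iff₀ h0]
  have hqpos : 0 < q := hs.trans hsq
  have hpos : ∀ m, 0 < b m ∧ q * b m ≤ b (m + 1) := by
    intro m
    induction m with
    | zero => exact ⟨h0, by rw [hq]; field_simp; exact le_rfl⟩
    | succ m ih =>
      have h1 : 0 < b (m + 1) := lt_of_lt_of_le (mul_pos hqpos ih.1) ih.2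
      refine ⟨h1, ?_⟩
      have := hlog m
      have h3 : b m * (q * b (m + 1)) ≤ b m * b (m + 2) := by nlinarith [ih.2]
      exact le_of_mul_le_mul_left h3 ih.1
  have hgrow : ∀ m, b 0 * q ^ m ≤ b m := by
    intro m
    induction m with
    | zero => simp
    | succ m ih =>
      calc b 0 * q ^ (m + 1) = q * (b 0 * q ^ m) := by ring
        _ ≤ q * b m := by gcongr
        _ ≤ _ := (hpos m).2
  have hratio : 1 < q / s := (one_lt_div hs).2 hsq
  obtain ⟨m, hm⟩ := pow_unbounded_of_one_lt (C / b 0) hratio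
  rw [div_lt_iff₀ h0, div_pow, div_mul_eq_mul_div, lt_div_iff₀ (pow_pos hs m)] at hm
  linarith [hgrow m, hdecay m, mul_comm (q ^ m) (b 0)]

/-- Poincaré inequality for the Gibbs measure, in the regime of Dobrushin's uniqueness condition:
the variance is at most twice the sum of the mean conditional variances. -/
theorem poincare (hκ : IsPairWeight ν κ p) (hn : n ≠ 0) (hnp : 9 * (n * p) ≤ 1)
    (hZ : 0 < ∫ x : Fin n → T, gibbsWeight κ x ∂(Measure.pi fun _ => ν))
    {f : (Fin n → T) → ℝ} (hf : BddMeas f)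
    (hf0 : ∫ x, f x * gibbsWeight κ x ∂(Measure.pi fun _ => ν) = 0) :
    ∫ x, f x ^ 2 * gibbsWeight κ x ∂(Measure.pi fun _ => ν) ≤
      2 * ∑ i, ∫ x, f x * (f x - heatBath ν κ i f x) * gibbsWeight κ x
        ∂(Measure.pi fun _ => ν) := by
  set μ : Measure (Fin n → T) := Measure.pi fun _ => ν with hμ
  set W : (Fin n → T) → ℝ := gibbsWeight κ with hWdef
  set K : ((Fin n → T) → ℝ) → (Fin n → T) → ℝ := gibbsSampler ν κ with hKdef
  have hW : BddMeas W := hκ.bddMeas_gibbsWeight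
  have hW0 : ∀ x, 0 ≤ W x := hκ.gibbsWeight_nonneg
  have hn0 : (0 : ℝ) < n := by exact_mod_cast Nat.pos_of_ne_zero hn
  have hn1 : (1 : ℝ) ≤ n := by exact_mod_cast Nat.one_le_iff_ne_zero.2 hn
  have hKb : ∀ m, BddMeas (K^[m] f) := by
    intro m
    induction m with
    | zero => exact hf
    | succ m ih => rw [iterate_succ_apply']; exact ih.gibbsSampler hκ hnp
  have hKint : ∀ {g h : (Fin n → T) → ℝ}, BddMeas g → BddMeas h →
      ∫ x, g x * K h x * W x ∂μ = (n : ℝ)⁻¹ * ∑ i, ∫ x, g x * heatBath ν κ i h x * W x ∂μ := by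
    intro g h hg hh
    rw [← integral_finsetSum _ fun i _ => ((hg.mul (hh.heatBath hκ hnp i)).mul hW).integrable μ,
      ← integral_const_mul]
    refine integral_congr_ae (ae_of_all _ fun x => ?_)
    simp only [hKdef, gibbsSampler, Finset.mul_sum, Finset.sum_mul]
    exact Finset.sum_congr rfl fun i _ => by ring
  have hsymm : ∀ {g h : (Fin n → T) → ℝ}, BddMeas g → BddMeas h →
      ∫ x, g x * K h x * W x ∂μ = ∫ x, h x * K g x * W x ∂μ := by
    intro g h hg hh
    rw [hKint hg hh, hKint hh hg]
    congr 1
    exact Finset.sum_congr rfl fun i _ => integral_mul_heatBath_comm hκ hnp hh hg i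
  have hK1 : K (fun _ => 1) = fun _ => 1 := by
    funext x
    simp only [hKdef, gibbsSampler]
    rw [Finset.sum_congr rfl fun i _ => heatBath_eq_self hκ hnp (g := fun _ => 1) i
      (fun _ _ => rfl) x]
    simp [hn0.ne']
  have hmean : ∀ m, ∫ x, (K^[m] f) x * W x ∂μ = 0 := by
    intro m
    induction m with
    | zero => exact hf0
    | succ m ih =>
      rw [iterate_succ_apply']
      have := hsymm (BddMeas.const 1) (hKb m)
      simpa [hK1, ih] using this
  obtain ⟨C, hC⟩ := hf.bdd
  have hr0 : 0 < 1 - 1 / (2 * (n : ℝ)) := by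
    rw [sub_pos, div_lt_one (by positivity)]; linarith
  set r := 1 - 1 / (2 * (n : ℝ)) with hr
  have hosc : ∀ m, ∀ x j z, |(K^[m] f) x - (K^[m] f) (update x j z)| ≤ r ^ m * (2 * C) := by
    intro m
    induction m with
    | zero =>
      intro x j z
      have h1 := abs_le.1 (hC x)
      have h2 := abs_le.1 (hC (update x j z))
      simp only [iterate_zero, id, pow_zero, one_mul]
      exact abs_le.2 ⟨by linarith, by linarith⟩
    | succ m ih =>
      intro x j z
      rw [iterate_succ_apply', pow_succ', mul_assoc]
      exact abs_gibbsSampler_sub_le hκ hnp (hKb m) ih x j z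
  -- a centred function is bounded by its oscillation
  have hsup : ∀ m x, |(K^[m] f) x| ≤ n * (r ^ m * (2 * C)) := by
    intro m x
    have h1 : (K^[m] f) x * ∫ y, W y ∂μ = ∫ y, ((K^[m] f) x - (K^[m] f) y) * W y ∂μ := by
      simp_rw [sub_mul]
      rw [integral_sub ((hW.const_mul _).integrable μ) (((hKb m).mul hW).integrable μ), hmean m,
        integral_const_mul, sub_zero]
    have h2 : |∫ y, ((K^[m] f) x - (K^[m] f) y) * W y ∂μ| ≤
        n * (r ^ m * (2 * C)) * ∫ y, W y ∂μ := by
      rw [← integral_const_mul]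
      refine abs_integral_le_of_abs_le ((hW.const_mul _).integrable μ) fun y => ?_
      rw [abs_mul, abs_of_nonneg (hW0 y)]
      exact mul_le_mul_of_nonneg_right (abs_sub_le_of_update (hosc m) x y) (hW0 y)
    rw [← h1, abs_mul, abs_of_pos hZ] at h2
    exact le_of_mul_le_mul_right h2 hZ
  set b : ℕ → ℝ := fun m => ∫ x, (K^[m] f) x ^ 2 * W x ∂μ with hb
  have hcontr : b 1 ≤ r ^ 2 * b 0 := by
    refine le_mul_of_logConvex (C := (n * (2 * C)) ^ 2 * ∫ y, W y ∂μ) (by positivity)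
      (fun m => integral_nonneg fun x => mul_nonneg (sq_nonneg _) (hW0 x)) ?_ ?_
    · intro m
      have h := hsymm (hKb (m + 1)) (hKb m)
      have h' : b (m + 1) = ∫ x, (K^[m] f) x * (K^[m + 2] f) x * W x ∂μ := by
        rw [iterate_succ_apply' K (m + 1) f, ← h, iterate_succ_apply' K m f]
        simp only [hb, iterate_succ_apply' K m f, sq]
      rw [h']
      exact sq_integral_mul_le (hKb m) (hKb (m + 2)) hW hW0
    · intro m
      have : (n * (2 * C)) ^ 2 * (∫ y, W y ∂μ) * (r ^ 2) ^ m =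
          ∫ y, (n * (r ^ m * (2 * C))) ^ 2 * W y ∂μ := by
        rw [integral_const_mul, ← pow_mul, mul_comm 2 m, pow_mul]; ring
      rw [this]
      refine integral_mono (((hKb m).pow 2).mul hW |>.integrable μ)
        ((hW.const_mul _).integrable μ) fun x => ?_
      exact mul_le_mul_of_nonneg_right (sq_le_sq' (abs_le.1 (hsup m x)).1
        (abs_le.1 (hsup m x)).2) (hW0 x)
  have hCS : (∫ x, f x * K f x * W x ∂μ) ^ 2 ≤ b 0 * b 1 :=
    sq_integral_mul_le hf (hKb 1) hW hW0
  have hb0 : 0 ≤ b 0 := integral_nonneg fun x => mul_nonneg (sq_nonneg _) (hW0 x)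
  have hle : ∫ x, f x * K f x * W x ∂μ ≤ r * b 0 := by
    refine le_of_sq_le_sq ?_ (by positivity)
    nlinarith
  have hsum : ∑ i, ∫ x, f x * (f x - heatBath ν κ i f x) * W x ∂μ =
      n * (b 0 - ∫ x, f x * K f x * W x ∂μ) := by
    rw [hKint hf hf]
    have : ∀ i, ∫ x, f x * (f x - heatBath ν κ i f x) * W x ∂μ =
        b 0 - ∫ x, f x * heatBath ν κ i f x * W x ∂μ := by
      intro i
      rw [hb, ← integral_sub (((hKb 0).pow 2).mul hW |>.integrable μ)
        ((hf.mul (hf.heatBath hκ hnp i)).mul hW |>.integrable μ)]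
      refine integral_congr_ae (ae_of_all _ fun x => ?_)
      simp only [iterate_zero, id]
      ring
    simp_rw [this]
    rw [Finset.sum_sub_distrib, Finset.sum_const, card_univ, Fintype.card_fin, nsmul_eq_mul]
    field_simp
  rw [hsum]
  have : b 0 ≤ 2 * (n * (b 0 - r * b 0)) := by
    rw [hr]; field_simp; linarith
  calc _ = b 0 := rfl
    _ ≤ 2 * (n * (b 0 - r * b 0)) := this
    _ ≤ _ := by gcongr

end Gibbs

end HardSphere

/-! ### The pair expectation in a translation invariant gas -/

namespace HardSphere

open MeasureTheory Finset Function

section TwoBody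

/-- The mean of a pair observable `η(s - t)`, weighted with `F(s) F(t)`, is bounded by its
integral and the second moment of `F(t)`. -/
theorem integral_pair_le {T X : Type*} [MeasurableSpace T] [MeasurableSpace X] [AddCommGroup T]
    [MeasurableSub₂ T] [MeasurableAdd T] {ν : Measure T} [IsProbabilityMeasure ν]
    [ν.IsAddLeftInvariant]
    {μ : Measure X} [IsProbabilityMeasure μ] {F : T × X → ℝ} {W : X → ℝ} {η : T → ℝ} {A : ℝ}
    (hF : BddMeas F) (hW : BddMeas W) (hη : BddMeas η) (hW0 : ∀ x, 0 ≤ W x) (hη0 : ∀ t, 0 ≤ η t)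
    (hηe : ∀ t, η (-t) = η t) (hA : ∀ t, ∫ x, F (t, x) ^ 2 * W x ∂μ = A) :
    ∫ x, ∫ s, ∫ t, η (s - t) * F (s, x) * F (t, x) * W x ∂ν ∂ν ∂μ ≤ A * ∫ t, η t ∂ν := by
  have hFs : BddMeas (fun q : (X × T) × T => F (q.1.2, q.1.1)) := hF.comp (by fun_prop)
  have hFt : BddMeas (fun q : (X × T) × T => F (q.2, q.1.1)) := hF.comp (by fun_prop)
  have hη' : BddMeas (fun q : (X × T) × T => η (q.1.2 - q.2)) := hη.comp (by fun_prop)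
  have hW' : BddMeas (fun q : (X × T) × T => W q.1.1) := hW.comp (by fun_prop)
  have hFW : BddMeas (fun q : X × T => F (q.2, q.1) ^ 2 * W q.1) :=
    ((hF.comp (h := fun q : X × T => (q.2, q.1)) (by fun_prop)).pow 2).mul
      (hW.comp measurable_fst)
  set I := ∫ t, η t ∂ν with hI
  have hsecond : ∫ x, ∫ s, F (s, x) ^ 2 * W x ∂ν ∂μ = A := by
    rw [integral_integral_swap (hFW.integrable _)]
    simp [hA]
  -- the two halves of the bound `F(s) F(t) ≤ (F(s) ^ 2 + F(t) ^ 2) / 2`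
  have hG1 : BddMeas (fun q : (X × T) × T => η (q.1.2 - q.2) * F (q.1.2, q.1.1) ^ 2 * W q.1.1) :=
    (hη'.mul (hFs.pow 2)).mul hW'
  have hG2 : BddMeas (fun q : (X × T) × T => η (q.1.2 - q.2) * F (q.2, q.1.1) ^ 2 * W q.1.1) :=
    (hη'.mul (hFt.pow 2)).mul hW'
  have h1 : ∫ x, ∫ s, ∫ t, η (s - t) * F (s, x) ^ 2 * W x ∂ν ∂ν ∂μ = A * I := by
    have : ∀ x s, ∫ t, η (s - t) * F (s, x) ^ 2 * W x ∂ν = I * (F (s, x) ^ 2 * W x) := by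
      intro x s
      have hev : ∀ t, η (s - t) = η (t - s) := fun t => by rw [← hηe, neg_sub]
      simp_rw [mul_assoc, hev]
      rw [integral_mul_const, integral_sub_right_eq_self]
    simp_rw [this, integral_const_mul, hsecond, mul_comm]
  have h2 : ∫ x, ∫ s, ∫ t, η (s - t) * F (t, x) ^ 2 * W x ∂ν ∂ν ∂μ = A * I := by
    have hs : ∀ x, ∫ s, ∫ t, η (s - t) * F (t, x) ^ 2 * W x ∂ν ∂ν =
        ∫ t, I * (F (t, x) ^ 2 * W x) ∂ν := by
      intro x
      rw [integral_integral_swap ((hG2.comp (h := fun q : T × T => ((x, q.1), q.2))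
        (by fun_prop)).integrable _)]
      refine integral_congr_ae (ae_of_all _ fun t => ?_)
      simp_rw [mul_assoc]
      rw [integral_mul_const, integral_sub_right_eq_self]
    simp_rw [hs, integral_const_mul, hsecond, mul_comm]
  have it : ∀ {G : (X × T) × T → ℝ}, BddMeas G →
      ∫ x, ∫ s, ∫ t, G ((x, s), t) ∂ν ∂ν ∂μ = ∫ q, G q ∂((μ.prod ν).prod ν) := by
    intro G hG
    rw [integral_prod _ (hG.integrable _),
      integral_prod _ ((hG.integral_prod_right ν).integrable _)]
  have hG : BddMeas (fun q : (X × T) × T =>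
      η (q.1.2 - q.2) * F (q.1.2, q.1.1) * F (q.2, q.1.1) * W q.1.1) :=
    ((hη'.mul hFs).mul hFt).mul hW'
  calc _ = ∫ q, η (q.1.2 - q.2) * F (q.1.2, q.1.1) * F (q.2, q.1.1) * W q.1.1
        ∂((μ.prod ν).prod ν) := it hG
    _ ≤ ∫ q, (1 / 2 * (η (q.1.2 - q.2) * F (q.1.2, q.1.1) ^ 2 * W q.1.1) +
        1 / 2 * (η (q.1.2 - q.2) * F (q.2, q.1.1) ^ 2 * W q.1.1)) ∂((μ.prod ν).prod ν) := by
        refine integral_mono (hG.integrable _)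
          (((hG1.const_mul _).add (hG2.const_mul _)).integrable _) fun q => ?_
        have := mul_nonneg (mul_nonneg (hη0 (q.1.2 - q.2)) (hW0 q.1.1))
          (sq_nonneg (F (q.1.2, q.1.1) - F (q.2, q.1.1)))
        simp only
        nlinarith
    _ = 1 / 2 * (A * I) + 1 / 2 * (A * I) := by
        rw [integral_add ((hG1.const_mul _).integrable _) ((hG2.const_mul _).integrable _),
          integral_const_mul, integral_const_mul, ← it hG1, ← it hG2, h1, h2]
    _ = _ := by ring

theorem integral_pi_succ {T : Type*} [MeasurableSpace T] {ν : Measure T} [IsProbabilityMeasure ν]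
    {n : ℕ} {G : (Fin (n + 1) → T) → ℝ} (hG : BddMeas G) :
    ∫ x, G x ∂(Measure.pi fun _ => ν) =
      ∫ x, ∫ t, G (Fin.cons t x) ∂ν ∂(Measure.pi fun _ : Fin n => ν) := by
  have h := (measurePreserving_piFinSuccAbove (fun _ : Fin (n + 1) => ν) 0).symm
  have hb := hG.comp h.measurable
  rw [← h.integral_comp', integral_prod_symm _ (hb.integrable _)]
  simp [MeasurableEquiv.piFinSuccAbove, Fin.insertNthEquiv, Fin.insertNth_zero']

variable {T : Type*} [AddCommGroup T] {n : ℕ}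

/-- The interaction of a test particle at `t` with the configuration `x`. -/
def testWeight (φ : T → ℝ) (y : T × (Fin n → T)) : ℝ := ∏ j, φ (y.1 - y.2 j)

theorem gibbsWeight_cons (φ : T → ℝ) (t : T) (x : Fin n → T) :
    gibbsWeight (fun x y => φ (x - y)) (Fin.cons t x : Fin (n + 1) → T) =
      testWeight φ (t, x) * gibbsWeight (fun x y => φ (x - y)) x := by
  simp only [gibbsWeight, testWeight]
  rw [Fin.prod_univ_succ]
  congr 1
  · rw [Fin.prod_Ioi_zero]; simp
  · refine Finset.prod_congr rfl fun i _ => ?_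
    rw [Fin.prod_Ioi_succ]; simp

variable [MeasurableSpace T] {ν : Measure T} {φ : T → ℝ} {p q : ℝ}

/-- A translation invariant pair weight `φ(x - y)` with `φ` even and values in `[0, 1]`, and bounds
on the first two moments of `1 - φ`. -/
structure IsConvWeight (ν : Measure T) (φ : T → ℝ) (p q : ℝ) : Prop where
  meas : Measurable φ
  even : ∀ x, φ (-x) = φ x
  nonneg : ∀ x, 0 ≤ φ x
  le_one : ∀ x, φ x ≤ 1
  first : ∫ z, (1 - φ z) ∂ν ≤ p
  second : ∫ z, (1 - φ z) ^ 2 ∂ν ≤ q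

theorem IsConvWeight.bddMeas (h : IsConvWeight ν φ p q) : BddMeas φ :=
  .of_mem_Icc h.meas h.nonneg h.le_one

/-- By translation invariance, the moments of the test weight do not depend on the position of the
test particle. -/
theorem integral_testWeight_pow [MeasurableAdd T] [IsProbabilityMeasure ν]
    [ν.IsAddLeftInvariant] (φ : T → ℝ) (k : ℕ) (t : T) :
    ∫ x : Fin n → T, testWeight φ (t, x) ^ k * gibbsWeight (fun x y => φ (x - y)) x
        ∂(Measure.pi fun _ => ν) =
      ∫ x : Fin n → T, testWeight φ (0, x) ^ k * gibbsWeight (fun x y => φ (x - y)) x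
        ∂(Measure.pi fun _ => ν) := by
  rw [← integral_add_left_eq_self (fun x : Fin n → T => testWeight φ (t, x) ^ k *
    gibbsWeight (fun x y => φ (x - y)) x) (fun _ => t)]
  simp [testWeight, gibbsWeight]

variable [MeasurableSub₂ T]

theorem IsConvWeight.bddMeas_testWeight (h : IsConvWeight ν φ p q) :
    BddMeas (testWeight (n := n) φ) :=
  .prod _ fun j _ => h.bddMeas.comp (by fun_prop)

variable [MeasurableAdd T] [ν.IsAddLeftInvariant]

theorem IsConvWeight.isPairWeight (h : IsConvWeight ν φ p q) :
    IsPairWeight ν (fun x y => φ (x - y)) p where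
  meas := h.meas.comp measurable_sub
  symm x y := by rw [← h.even, neg_sub]
  nonneg _ _ := h.nonneg _
  le_one _ _ := h.le_one _
  defect x := by
    rw [integral_sub_right_eq_self (fun z => 1 - φ z) x]
    exact h.first

variable [IsProbabilityMeasure ν]

theorem IsConvWeight.one_sub_le_integral_testWeight (h : IsConvWeight ν φ p q) (x : Fin n → T) :
    1 - n * p ≤ ∫ t, testWeight φ (t, x) ∂ν := by
  simpa [testWeight] using h.isPairWeight.one_sub_le_integral_prod univ x

theorem IsConvWeight.integral_gibbsWeight_pos (h : IsConvWeight ν φ p q) (hnp : 9 * (n * p) ≤ 1) :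
    0 < ∫ x : Fin n → T, gibbsWeight (fun x y => φ (x - y)) x ∂(Measure.pi fun _ => ν) := by
  have hp := h.isPairWeight.defect_nonneg
  induction n with
  | zero => simp [gibbsWeight]
  | succ n ih =>
    push_cast at hnp
    have hW := h.isPairWeight.bddMeas_gibbsWeight (n := n)
    have hF := h.bddMeas_testWeight (n := n)
    rw [integral_pi_succ h.isPairWeight.bddMeas_gibbsWeight]
    simp_rw [gibbsWeight_cons, integral_mul_const]
    refine lt_of_lt_of_le (mul_pos (show (0 : ℝ) < 8 / 9 by norm_num) (ih (by nlinarith))) ?_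
    rw [← integral_const_mul]
    refine integral_mono ((hW.const_mul _).integrable _)
      ((((hF.comp (h := fun y : (Fin n → T) × T => (y.2, y.1)) (by fun_prop)).integral_prod_right
        ν).mul hW).integrable _) fun x => ?_
    exact mul_le_mul_of_nonneg_right (by nlinarith [h.one_sub_le_integral_testWeight x])
      (h.isPairWeight.gibbsWeight_nonneg x)

/-- The one-particle second moment of `1 - φ` under the Gibbs measure. -/
theorem IsConvWeight.integral_site_sq_le (h : IsConvWeight ν φ p q) (hnp : 9 * (n * p) ≤ 1)
    (i : Fin n) :
    ∫ x, (1 - φ (0 - x i)) ^ 2 * gibbsWeight (fun x y => φ (x - y)) x ∂(Measure.pi fun _ => ν) ≤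
      9 / 8 * q * ∫ x : Fin n → T, gibbsWeight (fun x y => φ (x - y)) x
        ∂(Measure.pi fun _ => ν) := by
  have hκ := h.isPairWeight
  have hq : 0 ≤ q := (integral_nonneg fun z => sq_nonneg _).trans h.second
  obtain ⟨R, hR, hR0, hRi, hW⟩ := exists_gibbsWeight_eq (n := n) hκ i
  have hw := hκ.bddMeas_siteWeight i
  have hu : BddMeas (fun x : Fin n → T => (1 - φ (0 - x i)) ^ 2) :=
    ((BddMeas.const 1).sub (h.bddMeas.comp (by fun_prop))).pow 2
  have e1 : ∫ x, gibbsWeight (fun x y => φ (x - y)) x ∂(Measure.pi fun _ : Fin n => ν) =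
      ∫ x, siteIntegral ν i (siteWeight (fun x y => φ (x - y)) i) x * R x
        ∂(Measure.pi fun _ => ν) := by
    simp_rw [hW]
    rw [← integral_siteIntegral (hw.mul hR) i]
    exact integral_congr_ae (ae_of_all _ fun x => siteIntegral_mul_right i _ R hRi x)
  have e2 : ∫ x, (1 - φ (0 - x i)) ^ 2 * gibbsWeight (fun x y => φ (x - y)) x
      ∂(Measure.pi fun _ => ν) = ∫ x, siteIntegral ν i (fun x => (1 - φ (0 - x i)) ^ 2 *
        siteWeight (fun x y => φ (x - y)) i x) x * R x ∂(Measure.pi fun _ => ν) := by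
    simp_rw [hW, ← mul_assoc]
    rw [← integral_siteIntegral ((hu.mul hw).mul hR) i]
    exact integral_congr_ae (ae_of_all _ fun x => siteIntegral_mul_right i _ R hRi x)
  rw [e1, e2, ← integral_const_mul]
  refine integral_mono (((hu.mul hw).siteIntegral i).mul hR |>.integrable _)
    (((hw.siteIntegral i).mul hR).const_mul _ |>.integrable _) fun x => ?_
  simp only
  rw [← mul_assoc]
  refine mul_le_mul_of_nonneg_right ?_ (hR0 x)
  have h1 : siteIntegral ν i (fun x => (1 - φ (0 - x i)) ^ 2 *
      siteWeight (fun x y => φ (x - y)) i x) x ≤ q := by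
    refine le_trans ?_ h.second
    have hφ2 : BddMeas (fun z => (1 - φ z) ^ 2) := ((BddMeas.const 1).sub h.bddMeas).pow 2
    refine integral_mono ((hu.mul hw).comp (measurable_update x) |>.integrable _)
      (hφ2.integrable _) fun z => ?_
    simp only [update_self, zero_sub, h.even]
    exact mul_le_of_le_one_right (sq_nonneg _) (hκ.siteWeight_le_one i _)
  have h2 := hκ.le_siteIntegral_siteWeight (n := n) i x
  nlinarith

/-- The variance of the test weight is `O(n q)`: the Poincaré inequality, with the bound
`(1 - φ(x_i)) ^ 2` for the effect of removing particle `i`. -/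
theorem IsConvWeight.variance_testWeight_le (h : IsConvWeight ν φ p q) (hn : n ≠ 0)
    (hnp : 9 * (n * p) ≤ 1) {Z A B : ℝ}
    (hZ : ∫ x : Fin n → T, gibbsWeight (fun x y => φ (x - y)) x ∂(Measure.pi fun _ => ν) = Z)
    (hA : ∫ x : Fin n → T, testWeight φ (0, x) ^ 2 * gibbsWeight (fun x y => φ (x - y)) x
      ∂(Measure.pi fun _ => ν) = A * Z)
    (hB : ∫ x : Fin n → T, testWeight φ (0, x) * gibbsWeight (fun x y => φ (x - y)) x
      ∂(Measure.pi fun _ => ν) = B * Z) : A ≤ B ^ 2 + 9 / 4 * (n * q) := by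
  have hκ := h.isPairWeight
  have hW := hκ.bddMeas_gibbsWeight (n := n)
  have hZ0 : 0 < Z := hZ ▸ h.integral_gibbsWeight_pos hnp
  have hF : BddMeas (fun x : Fin n → T => testWeight φ (0, x)) :=
    h.bddMeas_testWeight.comp (by fun_prop)
  have hf := hF.sub (.const B)
  have hvar : ∫ x : Fin n → T, (testWeight φ (0, x) - B) ^ 2 *
      gibbsWeight (fun x y => φ (x - y)) x ∂(Measure.pi fun _ => ν) = (A - B ^ 2) * Z := by
    have e : ∀ x : Fin n → T, (testWeight φ (0, x) - B) ^ 2 *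
        gibbsWeight (fun x y => φ (x - y)) x = testWeight φ (0, x) ^ 2 *
        gibbsWeight (fun x y => φ (x - y)) x - 2 * B * (testWeight φ (0, x) *
        gibbsWeight (fun x y => φ (x - y)) x) + B ^ 2 *
        gibbsWeight (fun x y => φ (x - y)) x := fun x => by ring
    simp_rw [e]
    rw [integral_add ((((hF.pow 2).mul hW).sub ((hF.mul hW).const_mul _)).integrable _)
      ((hW.const_mul _).integrable _), integral_sub (((hF.pow 2).mul hW).integrable _)
      (((hF.mul hW).const_mul _).integrable _), integral_const_mul, integral_const_mul, hZ, hA, hB]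
    ring
  have hpo := poincare hκ hn hnp (hZ ▸ hZ0) hf (by
    simp_rw [sub_mul]
    rw [integral_sub ((hF.mul hW).integrable _) ((hW.const_mul _).integrable _),
      integral_const_mul, hB, hZ, sub_self])
  have hsite : ∀ i : Fin n, ∫ x, (testWeight φ (0, x) - B) * ((testWeight φ (0, x) - B) -
      heatBath ν (fun x y => φ (x - y)) i (fun x => testWeight φ (0, x) - B) x) *
      gibbsWeight (fun x y => φ (x - y)) x ∂(Measure.pi fun _ => ν) ≤ 9 / 8 * q * Z := by
    intro i
    have hg : BddMeas (fun x : Fin n → T => ∏ j ∈ univ.erase i, φ (0 - x j)) :=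
      .prod _ fun j _ => h.bddMeas.comp (by fun_prop)
    refine (integral_mul_sub_heatBath_le hκ hnp hf (hg.sub (.const B)) i ?_).trans
      (le_trans ?_ ((h.integral_site_sq_le hnp i).trans_eq (by rw [hZ])))
    · intro x z
      congr 1
      exact Finset.prod_congr rfl fun k hk => by rw [update_of_ne (ne_of_mem_erase hk)]
    · refine integral_mono ((((hf.sub (hg.sub (.const B))).pow 2).mul hW).integrable _)
        ((((BddMeas.const 1).sub (h.bddMeas.comp (by fun_prop))).pow 2).mul hW |>.integrable _)
        fun x => ?_
      refine mul_le_mul_of_nonneg_right ?_ (hκ.gibbsWeight_nonneg x)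
      have hsplit : testWeight φ (0, x) = φ (0 - x i) * ∏ j ∈ univ.erase i, φ (0 - x j) :=
        (Finset.mul_prod_erase _ _ (mem_univ i)).symm
      simp only [hsplit]
      set g := ∏ j ∈ univ.erase i, φ (0 - x j)
      have g0 : 0 ≤ g := Finset.prod_nonneg fun _ _ => h.nonneg _
      have g1 : g ≤ 1 := Finset.prod_le_one (fun _ _ => h.nonneg _) fun _ _ => h.le_one _
      have : (φ (0 - x i) * g - B - (g - B)) ^ 2 = g ^ 2 * (1 - φ (0 - x i)) ^ 2 := by ring
      rw [this]
      exact mul_le_of_le_one_left (sq_nonneg _) (pow_le_one₀ g0 g1)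
  rw [hvar] at hpo
  have hsum := hpo.trans (mul_le_mul_of_nonneg_left (Finset.sum_le_sum fun i _ => hsite i)
    zero_le_two)
  rw [Finset.sum_const, card_univ, Fintype.card_fin, nsmul_eq_mul] at hsum
  have : (A - B ^ 2) * Z ≤ (9 / 4 * (n * q)) * Z := by linarith
  linarith [le_of_mul_le_mul_right this hZ0]

/-- The two-particle marginal: given the other particles, the first two interact with each other
and, through their test weights, with the rest. -/
theorem IsConvWeight.integral_pair_eq (h : IsConvWeight ν φ p q) {ψ : T → ℝ} (hψ : BddMeas ψ) :
    ∫ x : Fin (n + 2) → T, ψ (x 0 - x 1) * gibbsWeight (fun x y => φ (x - y)) x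
        ∂(Measure.pi fun _ => ν) =
      ∫ x : Fin n → T, ∫ s, ∫ t, (ψ (t - s) * φ (t - s)) * testWeight φ (s, x) *
        testWeight φ (t, x) * gibbsWeight (fun x y => φ (x - y)) x ∂ν ∂ν
        ∂(Measure.pi fun _ => ν) := by
  have hG : BddMeas (fun x : Fin (n + 2) → T => ψ (x 0 - x 1) *
      gibbsWeight (fun x y => φ (x - y)) x) :=
    (hψ.comp (by fun_prop)).mul h.isPairWeight.bddMeas_gibbsWeight
  have hG' : BddMeas (fun x : Fin (n + 1) → T => ∫ t, ψ ((Fin.cons t x : Fin (n + 2) → T) 0 -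
      (Fin.cons t x : Fin (n + 2) → T) 1) *
      gibbsWeight (fun x y => φ (x - y)) (Fin.cons t x : Fin (n + 2) → T) ∂ν) := by
    refine BddMeas.integral_prod_right (F := fun y : (Fin (n + 1) → T) × T =>
      ψ ((Fin.cons y.2 y.1 : Fin (n + 2) → T) 0 - (Fin.cons y.2 y.1 : Fin (n + 2) → T) 1) *
      gibbsWeight (fun x y => φ (x - y)) (Fin.cons y.2 y.1 : Fin (n + 2) → T)) ?_ ν
    refine hG.comp (h := fun y : (Fin (n + 1) → T) × T => (Fin.cons y.2 y.1 : Fin (n + 2) → T)) ?_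
    refine measurable_pi_iff.2 fun k => ?_
    refine Fin.cases ?_ (fun k => ?_) k
    · simpa using measurable_snd
    · simpa [Function.comp_def] using (measurable_pi_apply k).comp measurable_fst
  rw [integral_pi_succ hG, integral_pi_succ hG']
  refine integral_congr_ae (ae_of_all _ fun x => ?_)
  refine integral_congr_ae (ae_of_all _ fun s => ?_)
  refine integral_congr_ae (ae_of_all _ fun t => ?_)
  have h1 : (Fin.cons t (Fin.cons s x) : Fin (n + 2) → T) 1 = s := rfl
  have h2 : testWeight φ (t, (Fin.cons s x : Fin (n + 1) → T)) =
      φ (t - s) * testWeight φ (t, x) := by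
    simp [testWeight, Fin.prod_univ_succ]
  simp only [gibbsWeight_cons, h1, h2, Fin.cons_zero]
  ring

/-- The two-body bound: up to a relative error `O(n q + p)`, the expectation of `ψ(x_0 - x_1)` in
the Gibbs measure of `n + 2` particles is at most that in the measure of just two particles. -/
theorem IsConvWeight.two_body (h : IsConvWeight ν φ p q) (hn : n ≠ 0) (hnp : 9 * (n * p) ≤ 1)
    (hqp : q ≤ p) {ψ : T → ℝ} (hψ : BddMeas ψ) (hψ0 : ∀ t, 0 ≤ ψ t) (hψe : ∀ t, ψ (-t) = ψ t) :
    0 < ∫ x : Fin (n + 2) → T, gibbsWeight (fun x y => φ (x - y)) x ∂(Measure.pi fun _ => ν) ∧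
    (1 - 2 * p) * ∫ x : Fin (n + 2) → T, ψ (x 0 - x 1) * gibbsWeight (fun x y => φ (x - y)) x
        ∂(Measure.pi fun _ => ν) ≤
      (1 + 3 * (n * q)) * (∫ t, ψ t * φ t ∂ν) *
        ∫ x : Fin (n + 2) → T, gibbsWeight (fun x y => φ (x - y)) x ∂(Measure.pi fun _ => ν) := by
  have hκ := h.isPairWeight
  have hp := hκ.defect_nonneg
  have hn1 : (1 : ℝ) ≤ n := by exact_mod_cast Nat.one_le_iff_ne_zero.2 hn
  have hW := hκ.bddMeas_gibbsWeight (n := n)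
  have hW0 : ∀ x : Fin n → T, 0 ≤ gibbsWeight (fun x y => φ (x - y)) x := hκ.gibbsWeight_nonneg
  have hF := h.bddMeas_testWeight (n := n)
  set μ : Measure (Fin n → T) := Measure.pi fun _ => ν with hμ
  set W : (Fin n → T) → ℝ := gibbsWeight (fun x y => φ (x - y)) with hWdef
  obtain ⟨Z, hZ⟩ : ∃ Z, ∫ x, W x ∂μ = Z := ⟨_, rfl⟩
  have hZ0 : 0 < Z := hZ ▸ h.integral_gibbsWeight_pos hnp
  obtain ⟨A, hA⟩ : ∃ A, ∫ x, testWeight φ (0, x) ^ 2 * W x ∂μ = A * Z :=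
    ⟨_, (div_mul_cancel₀ _ hZ0.ne').symm⟩
  obtain ⟨B, hB⟩ : ∃ B, ∫ x, testWeight φ (0, x) * W x ∂μ = B * Z :=
    ⟨_, (div_mul_cancel₀ _ hZ0.ne').symm⟩
  have hAt : ∀ t, ∫ x, testWeight φ (t, x) ^ 2 * W x ∂μ = A * Z := fun t =>
    (integral_testWeight_pow φ 2 t).trans hA
  have hBt : ∀ t, ∫ x, testWeight φ (t, x) * W x ∂μ = B * Z := fun t => by
    have := integral_testWeight_pow (ν := ν) (n := n) φ 1 t
    simp only [pow_one] at this
    exact this.trans hB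
  have hq : 0 ≤ q := (integral_nonneg fun z => sq_nonneg _).trans h.second
  have hvar := h.variance_testWeight_le hn hnp hZ hA hB
  have hF' : BddMeas (fun y : (Fin n → T) × T => testWeight φ (y.2, y.1)) :=
    hF.comp (by fun_prop)
  have hav := hF'.integral_prod_right ν
  have hav1 : ∫ x, (∫ t, testWeight φ (t, x) ∂ν) * W x ∂μ = B * Z := by
    simp_rw [← integral_mul_const]
    rw [integral_integral_swap ((hF'.mul (hW.comp measurable_fst)).integrable _)]
    simp [hBt]
  have hB89 : 8 / 9 ≤ B := by
    have : 8 / 9 * Z ≤ B * Z := by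
      rw [← hav1, ← hZ, ← integral_const_mul]
      refine integral_mono ((hW.const_mul _).integrable _) ((hav.mul hW).integrable _) fun x => ?_
      exact mul_le_mul_of_nonneg_right (by linarith [h.one_sub_le_integral_testWeight x]) (hW0 x)
    exact le_of_mul_le_mul_right this hZ0
  -- the denominator, `E(1) - E(1 - φ)`
  have hden : Z * (B ^ 2 - p * A) ≤ ∫ x : Fin (n + 2) → T, gibbsWeight (fun x y => φ (x - y)) x
      ∂(Measure.pi fun _ => ν) := by
    have e := h.integral_pair_eq (n := n) (BddMeas.const 1)
    simp_rw [one_mul, ← hWdef] at e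
    rw [e]
    have hE : ∀ x, ∫ s, ∫ t, φ (t - s) * testWeight φ (s, x) * testWeight φ (t, x) * W x ∂ν ∂ν =
        (∫ t, testWeight φ (t, x) ∂ν) ^ 2 * W x - ∫ s, ∫ t, (1 - φ (s - t)) *
          testWeight φ (s, x) * testWeight φ (t, x) * W x ∂ν ∂ν := by
      intro x
      have bs : BddMeas (fun y : T × T => testWeight φ (y.1, x)) := hF.comp (by fun_prop)
      have bt : BddMeas (fun y : T × T => testWeight φ (y.2, x)) := hF.comp (by fun_prop)
      have bφ : BddMeas (fun y : T × T => 1 - φ (y.1 - y.2)) :=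
        (BddMeas.const 1).sub (h.bddMeas.comp (by fun_prop))
      have b1 : BddMeas (fun y : T × T => testWeight φ (y.1, x) * testWeight φ (y.2, x) * W x) :=
        (bs.mul bt).mul (.const _)
      have b2 : BddMeas (fun y : T × T => (1 - φ (y.1 - y.2)) * testWeight φ (y.1, x) *
          testWeight φ (y.2, x) * W x) := ((bφ.mul bs).mul bt).mul (.const _)
      have i1 : (∫ t, testWeight φ (t, x) ∂ν) ^ 2 * W x =
          ∫ s, ∫ t, testWeight φ (s, x) * testWeight φ (t, x) * W x ∂ν ∂ν := by
        simp_rw [integral_mul_const, integral_const_mul]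
        rw [integral_mul_const]
        ring
      rw [i1, ← integral_sub ((b1.integral_prod_right ν).integrable ν)
        ((b2.integral_prod_right ν).integrable ν)]
      refine integral_congr_ae (ae_of_all _ fun s => ?_)
      simp only
      rw [← integral_sub ((b1.comp (h := fun t => (s, t)) (by fun_prop)).integrable ν)
        ((b2.comp (h := fun t => (s, t)) (by fun_prop)).integrable ν)]
      refine integral_congr_ae (ae_of_all _ fun t => ?_)
      have : φ (t - s) = φ (s - t) := by rw [← h.even, neg_sub]
      simp only [this]
      ring
    have b3 : BddMeas (fun x => ∫ s, ∫ t, (1 - φ (s - t)) *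
          testWeight φ (s, x) * testWeight φ (t, x) * W x ∂ν ∂ν) := by
      have : BddMeas (fun y : ((Fin n → T) × T) × T => (1 - φ (y.1.2 - y.2)) *
          testWeight φ (y.1.2, y.1.1) * testWeight φ (y.2, y.1.1) * W y.1.1) :=
        ((((BddMeas.const 1).sub (h.bddMeas.comp (by fun_prop))).mul (hF.comp (by fun_prop))).mul
          (hF.comp (by fun_prop))).mul (hW.comp (by fun_prop))
      exact (this.integral_prod_right ν).integral_prod_right ν
    simp_rw [hE]
    rw [integral_sub (((hav.pow 2).mul hW).integrable _) (b3.integrable _)]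
    have hup := integral_pair_le (ν := ν) (μ := μ) (F := testWeight φ) (η := fun t => 1 - φ t) hF
      hW ((BddMeas.const 1).sub h.bddMeas) hW0 (fun t => sub_nonneg.2 (h.le_one t))
      (fun t => by rw [h.even]) hAt
    have hA0 : 0 ≤ A * Z := hA ▸ integral_nonneg fun x => mul_nonneg (sq_nonneg _) (hW0 x)
    have hup' := hup.trans (mul_le_mul_of_nonneg_left h.first hA0)
    have hCS := sq_integral_mul_le (μ := μ) hav (BddMeas.const 1) hW hW0
    simp only [mul_one, one_pow, one_mul] at hCS
    rw [hav1, hZ] at hCS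
    have : B ^ 2 * Z ≤ ∫ x, (∫ t, testWeight φ (t, x) ∂ν) ^ 2 * W x ∂μ :=
      le_of_mul_le_mul_right (by linarith [mul_pow B Z 2]) hZ0
    linarith
  have hnum : ∫ x : Fin (n + 2) → T, ψ (x 0 - x 1) * gibbsWeight (fun x y => φ (x - y)) x
      ∂(Measure.pi fun _ => ν) ≤ A * Z * ∫ t, ψ t * φ t ∂ν := by
    rw [h.integral_pair_eq hψ]
    have hev : ∀ s t, ψ (t - s) * φ (t - s) = ψ (s - t) * φ (s - t) := fun s t => by
      rw [← h.even, ← hψe, neg_sub]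
    simp_rw [hev]
    exact integral_pair_le (F := testWeight φ) (η := fun t => ψ t * φ t) hF hW (hψ.mul h.bddMeas)
      hW0 (fun t => mul_nonneg (hψ0 t) (h.nonneg t)) (fun t => by rw [hψe, h.even]) hAt
  set I := ∫ t, ψ t * φ t ∂ν
  have hI : 0 ≤ I := integral_nonneg fun t => mul_nonneg (hψ0 t) (h.nonneg t)
  set D := ∫ x : Fin (n + 2) → T, gibbsWeight (fun x y => φ (x - y)) x ∂(Measure.pi fun _ => ν)
  have hnq : n * q ≤ n * p := by gcongr
  have hnq0 : 0 ≤ n * q := by positivity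
  have hp9 : p ≤ 1 / 9 := by nlinarith
  have hB2 : 64 / 81 ≤ B ^ 2 := by nlinarith
  have hA2 : A ≤ B ^ 2 * (1 + 3 * (n * q)) := by nlinarith
  have hA3 : A ≤ B ^ 2 * 2 := hA2.trans (by nlinarith)
  have hD : Z * B ^ 2 * (1 - 2 * p) ≤ D := by
    refine le_trans ?_ hden
    rw [mul_assoc]
    refine mul_le_mul_of_nonneg_left ?_ hZ0.le
    nlinarith
  have hD0 : 0 < D := lt_of_lt_of_le (mul_pos (by positivity) (by linarith)) hD
  refine ⟨hD0, ?_⟩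
  calc _ ≤ (1 - 2 * p) * (A * Z * I) := mul_le_mul_of_nonneg_left hnum (by linarith)
    _ ≤ (1 - 2 * p) * (B ^ 2 * (1 + 3 * (n * q)) * Z * I) := by
        have : 0 ≤ 1 - 2 * p := by linarith
        gcongr
    _ = (1 + 3 * (n * q)) * I * (Z * B ^ 2 * (1 - 2 * p)) := by ring
    _ ≤ _ := by gcongr

end TwoBody

end HardSphere

/-! ### Radial functions, the maximum principle and the Neumann wave number -/

namespace HardSphere

open Set Filter

section Calculus

theorem laplacian_eq_sum (f : R3 → ℝ) (x : R3) :
    Laplacian.laplacian f x = ∑ i, fderiv ℝ (fderiv ℝ f) x (EuclideanSpace.basisFun (Fin 3) ℝ i)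
      (EuclideanSpace.basisFun (Fin 3) ℝ i) := by
  rw [InnerProductSpace.laplacian_eq_iteratedFDeriv_orthonormalBasis f
    (EuclideanSpace.basisFun (Fin 3) ℝ)]
  simp [iteratedFDeriv_two_apply]

theorem hasDerivAt_line (x v : R3) (t : ℝ) : HasDerivAt (fun t : ℝ => x + t • v) v t := by
  simpa using ((hasDerivAt_id t).smul_const v).const_add x

theorem eventually_hasDerivAt_line {f : R3 → ℝ} {x : R3} (hf : ContDiffAt ℝ 2 f x) (v : R3) :
    ∀ᶠ t in 𝓝 (0 : ℝ), HasDerivAt (fun t : ℝ => f (x + t • v)) (fderiv ℝ f (x + t • v) v) t := by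
  have hev : ∀ᶠ y in 𝓝 x, ContDiffAt ℝ 2 f y := hf.eventually (by simp)
  have hc : Tendsto (fun t : ℝ => x + t • v) (𝓝 0) (𝓝 x) := by
    simpa using (hasDerivAt_line x v 0).continuousAt.tendsto
  filter_upwards [hc.eventually hev] with t ht
  exact (ht.differentiableAt (by simp)).hasFDerivAt.comp_hasDerivAt t (hasDerivAt_line x v t)

theorem hasDerivAt_fderiv_line {f : R3 → ℝ} {x : R3} (hf : ContDiffAt ℝ 2 f x) (v : R3) :
    HasDerivAt (fun t : ℝ => fderiv ℝ f (x + t • v) v) (fderiv ℝ (fderiv ℝ f) x v v) 0 := by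
  have h1 : ContDiffAt ℝ 1 (fderiv ℝ f) x := hf.fderiv_right (by norm_num)
  have h2 : HasFDerivAt (fderiv ℝ f) (fderiv ℝ (fderiv ℝ f) x) (x + (0 : ℝ) • v) := by
    simpa using (h1.differentiableAt (by simp)).hasFDerivAt
  have h3 := h2.comp_hasDerivAt (0 : ℝ) (hasDerivAt_line x v 0)
  exact h3.clm_apply (hasDerivAt_const (0 : ℝ) v) |>.congr_deriv (by simp)

theorem laplacian_nonpos_of_isLocalMax {f : R3 → ℝ} {x : R3} (hf : ContDiffAt ℝ 2 f x)
    (hmax : IsLocalMax f x) : Laplacian.laplacian f x ≤ 0 := by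
  rw [laplacian_eq_sum]
  refine Finset.sum_nonpos fun i _ => ?_
  set v := EuclideanSpace.basisFun (Fin 3) ℝ i
  set g : ℝ → ℝ := fun t => f (x + t • v) with hg
  have hline := eventually_hasDerivAt_line hf v
  have hd : deriv g =ᶠ[𝓝 0] fun t => fderiv ℝ f (x + t • v) v := hline.mono fun t ht => ht.deriv
  have hdd : deriv (deriv g) 0 = fderiv ℝ (fderiv ℝ f) x v v := by
    rw [hd.deriv_eq]; exact (hasDerivAt_fderiv_line hf v).deriv
  have hc : Tendsto (fun t : ℝ => x + t • v) (𝓝 0) (𝓝 x) := by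
    simpa using (hasDerivAt_line x v 0).continuousAt.tendsto
  have hgmax : IsLocalMax g 0 := by
    have : ∀ᶠ t in 𝓝 (0 : ℝ), f (x + t • v) ≤ f x := hc.eventually hmax
    simpa [IsLocalMax, IsMaxFilter, hg] using this
  have hg0 : deriv g 0 = 0 := hgmax.deriv_eq_zero
  by_contra! hpos
  rw [← hdd] at hpos
  have hmin := isLocalMin_of_deriv_deriv_pos hpos hg0 hline.self_of_nhds.continuousAt
  -- `g` is then locally constant, so that its second derivative vanishes
  have hconst : g =ᶠ[𝓝 0] fun _ => g 0 := by
    filter_upwards [hgmax, hmin] with t h1 h2 using le_antisymm h1 h2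
  have : deriv (deriv g) 0 = 0 := by
    have h1 : deriv g =ᶠ[𝓝 0] fun _ => 0 := by
      simpa using hconst.deriv
    rw [h1.deriv_eq]; simp
  linarith

theorem isOpen_shell (a l : ℝ) : IsOpen (shell a l) :=
  (isOpen_lt continuous_const continuous_norm).inter (isOpen_lt continuous_norm continuous_const)

theorem isCompact_closedShell (a l : ℝ) : IsCompact {x : R3 | a ≤ ‖x‖ ∧ ‖x‖ ≤ l} := by
  have : {x : R3 | a ≤ ‖x‖ ∧ ‖x‖ ≤ l} = Metric.closedBall 0 l ∩ {x | a ≤ ‖x‖} := by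
    ext x; simp [and_comm]
  rw [this]
  exact (isCompact_closedBall _ _).inter_right (isClosed_le continuous_const continuous_norm)

/-- Maximum principle for `Δ + lam` on a shell, in the presence of a positive strict
supersolution `w`: look at the maximum of `h / w`. -/
theorem nonpos_of_supersolution {a l lam : ℝ} {h w : R3 → ℝ}
    (hc : ContinuousOn h {x | a ≤ ‖x‖ ∧ ‖x‖ ≤ l}) (hd : ∀ x ∈ shell a l, ContDiffAt ℝ 2 h x)
    (hsub : ∀ x ∈ shell a l, 0 ≤ Laplacian.laplacian h x + lam * h x)
    (hbd : ∀ x, ‖x‖ = a ∨ ‖x‖ = l → h x ≤ 0)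
    (wc : ContinuousOn w {x | a ≤ ‖x‖ ∧ ‖x‖ ≤ l}) (wd : ∀ x ∈ shell a l, ContDiffAt ℝ 2 w x)
    (wpos : ∀ x, a ≤ ‖x‖ → ‖x‖ ≤ l → 0 < w x)
    (wsup : ∀ x ∈ shell a l, Laplacian.laplacian w x + lam * w x < 0)
    (x : R3) (hx : a ≤ ‖x‖ ∧ ‖x‖ ≤ l) : h x ≤ 0 := by
  obtain ⟨y, hy, hmax⟩ := (isCompact_closedShell a l).exists_isMaxOn ⟨x, hx⟩
    (hc.div wc fun y hy => (wpos y hy.1 hy.2).ne')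
  by_contra! hpos
  have hwx := wpos x hx.1 hx.2
  have hwy := wpos y hy.1 hy.2
  set M := h y / w y with hM
  have hMpos : 0 < M := (div_pos hpos hwx).trans_le (hmax hx)
  have hyM : h y = M * w y := by rw [hM]; field_simp
  have hyint : y ∈ shell a l := by
    refine ⟨lt_of_le_of_ne hy.1 fun he => ?_, lt_of_le_of_ne hy.2 fun he => ?_⟩
    · have := hbd y (Or.inl he.symm); nlinarith
    · have := hbd y (Or.inr he); nlinarith
  have hMw : ContDiffAt ℝ 2 (M • w) y := contDiffAt_const.smul (wd y hyint)
  have hloc : IsLocalMax (h - M • w) y := by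
    filter_upwards [(isOpen_shell a l).mem_nhds hyint] with z hz
    have h1 : h z / w z ≤ M := hmax (show z ∈ {x : R3 | a ≤ ‖x‖ ∧ ‖x‖ ≤ l} from ⟨hz.1.le, hz.2.le⟩)
    rw [div_le_iff₀ (wpos z hz.1.le hz.2.le)] at h1
    simp only [Pi.sub_apply, Pi.smul_apply, smul_eq_mul, hyM]
    linarith
  have h1 := laplacian_nonpos_of_isLocalMax ((hd y hyint).sub hMw) hloc
  change Laplacian.laplacian (h - M • w) y ≤ 0 at h1
  rw [ContDiffAt.laplacian_sub (hd y hyint) hMw,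
    InnerProductSpace.laplacian_smul M (wd y hyint), smul_eq_mul] at h1
  have h2 := hsub y hyint
  have h3 := wsup y hyint
  rw [hyM] at h2
  nlinarith

theorem hasFDerivAt_norm {x : R3} (hx : x ≠ 0) :
    HasFDerivAt (fun y : R3 => ‖y‖) (‖x‖⁻¹ • innerSL ℝ x) x := by
  have h := (hasStrictFDerivAt_norm_sq x).hasFDerivAt.sqrt (by simpa using hx)
  simp only [Real.sqrt_sq (norm_nonneg _)] at h
  refine h.congr_fderiv ?_
  ext v
  have : ‖x‖ ≠ 0 := norm_ne_zero_iff.2 hx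
  simp
  field_simp

theorem hasFDerivAt_radial {F : ℝ → ℝ} {F' : ℝ} {x : R3} (hx : x ≠ 0)
    (hF : HasDerivAt F F' ‖x‖) :
    HasFDerivAt (fun y : R3 => F ‖y‖) (F' • ‖x‖⁻¹ • innerSL ℝ x) x :=
  hF.comp_hasFDerivAt x (hasFDerivAt_norm hx)

/-- The Laplacian of a radial function, `F'' + 2 F' / r`. -/
theorem laplacian_radial {F F₁ : ℝ → ℝ} {F₂ : ℝ} {x : R3} (hx : x ≠ 0)
    (hf : ContDiffAt ℝ 2 (fun y : R3 => F ‖y‖) x) (h1 : ∀ r, 0 < r → HasDerivAt F (F₁ r) r)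
    (h2 : HasDerivAt F₁ F₂ ‖x‖) :
    Laplacian.laplacian (fun y : R3 => F ‖y‖) x = F₂ + 2 * F₁ ‖x‖ / ‖x‖ := by
  have hr : ‖x‖ ≠ 0 := norm_ne_zero_iff.2 hx
  have key : ∀ v : R3, fderiv ℝ (fderiv ℝ (fun y : R3 => F ‖y‖)) x v v =
      (F₂ / ‖x‖ ^ 2 - F₁ ‖x‖ / ‖x‖ ^ 3) * inner ℝ x v ^ 2 + F₁ ‖x‖ / ‖x‖ * ‖v‖ ^ 2 := by
    intro v
    refine (hasDerivAt_fderiv_line hf v).unique ?_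
    have hline := hasDerivAt_line x v 0
    have hc : Tendsto (fun t : ℝ => x + t • v) (𝓝 0) (𝓝 x) := by
      simpa using hline.continuousAt.tendsto
    have hev : (fun t : ℝ => fderiv ℝ (fun y : R3 => F ‖y‖) (x + t • v) v) =ᶠ[𝓝 0]
        fun t => F₁ ‖x + t • v‖ * (‖x + t • v‖⁻¹ * inner ℝ (x + t • v) v) := by
      filter_upwards [hc.eventually (isOpen_ne.mem_nhds hx)] with t ht
      rw [(hasFDerivAt_radial ht (h1 _ (norm_pos_iff.2 ht))).fderiv]
      simp
      rw [inner_add_left, real_inner_smul_left, real_inner_self_eq_norm_sq]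
      ring
    refine HasDerivAt.congr_of_eventuallyEq ?_ hev
    have hx0 : x + (0 : ℝ) • v = x := by simp
    have hn : HasDerivAt (fun t : ℝ => ‖x + t • v‖) (‖x‖⁻¹ * inner ℝ x v) 0 := by
      have := (hasFDerivAt_norm (x := x + (0 : ℝ) • v) (by simpa using hx)).comp_hasDerivAt
        (0 : ℝ) hline
      simpa [Function.comp_def] using this
    have hin : HasDerivAt (fun t : ℝ => inner ℝ (x + t • v) v) (‖v‖ ^ 2) 0 := by
      have := hline.inner ℝ (hasDerivAt_const (0 : ℝ) v)
      simpa using this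
    have hF1 : HasDerivAt (fun t : ℝ => F₁ ‖x + t • v‖) (F₂ * (‖x‖⁻¹ * inner ℝ x v)) 0 :=
      HasDerivAt.comp (0 : ℝ) (h₂ := F₁) (by simpa using h2) hn
    have hall := hF1.mul ((hn.inv (by simpa using hr)).mul hin)
    refine hall.congr_deriv ?_
    simp only [hx0, Pi.inv_apply, Pi.mul_apply]
    field_simp
    ring
  rw [laplacian_eq_sum]
  simp_rw [key]
  rw [Finset.sum_add_distrib, ← Finset.mul_sum]
  have hs : ∑ i, inner ℝ x (EuclideanSpace.basisFun (Fin 3) ℝ i) ^ 2 = ‖x‖ ^ 2 := by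
    rw [EuclideanSpace.norm_sq_eq]
    simp [EuclideanSpace.inner_single_right]
  rw [hs]
  simp
  field_simp
  ring

end Calculus

section SphericalWave

/-- The spherical wave `c sin(k (r - b)) / r`. -/
noncomputable def wave (c k b r : ℝ) : ℝ := c * Real.sin (k * (r - b)) / r

/-- The derivative of `wave`. -/
noncomputable def waveDeriv (c k b r : ℝ) : ℝ :=
  c * (k * r * Real.cos (k * (r - b)) - Real.sin (k * (r - b))) / r ^ 2

variable {c k b : ℝ}

theorem hasDerivAt_phase (k b r : ℝ) : HasDerivAt (fun r => k * (r - b)) k r := by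
  simpa using ((hasDerivAt_id r).sub_const b).const_mul k

theorem hasDerivAt_wave {r : ℝ} (hr : r ≠ 0) :
    HasDerivAt (wave c k b) (waveDeriv c k b r) r := by
  have h := (((hasDerivAt_phase k b r).sin.const_mul c).div (hasDerivAt_id r) hr)
  refine h.congr_deriv ?_
  simp only [waveDeriv, id]
  ring

theorem hasDerivAt_waveDeriv {r : ℝ} (hr : r ≠ 0) :
    HasDerivAt (waveDeriv c k b)
      (-k ^ 2 * wave c k b r - 2 * waveDeriv c k b r / r) r := by
  have hs := (hasDerivAt_phase k b r).sin
  have hcos := (hasDerivAt_phase k b r).cos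
  have h := (((((hasDerivAt_id r).const_mul k).mul hcos).sub hs).const_mul c).div
    ((hasDerivAt_id r).pow 2) (by simpa using hr)
  refine h.congr_deriv ?_
  simp only [waveDeriv, wave, id, Pi.sub_apply, Pi.mul_apply, Pi.pow_apply]
  field_simp
  ring

theorem contDiffAt_wave_norm {x : R3} (hx : x ≠ 0) :
    ContDiffAt ℝ 2 (fun y : R3 => wave c k b ‖y‖) x := by
  have hn : ContDiffAt ℝ 2 (fun y : R3 => ‖y‖) x := contDiffAt_id.norm ℝ hx
  unfold wave
  exact (contDiffAt_const.mul ((contDiffAt_const.mul (hn.sub contDiffAt_const)).sin)).div hn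
    (norm_ne_zero_iff.2 hx)

theorem laplacian_wave_norm {x : R3} (hx : x ≠ 0) :
    Laplacian.laplacian (fun y : R3 => wave c k b ‖y‖) x = -k ^ 2 * wave c k b ‖x‖ := by
  rw [laplacian_radial hx (contDiffAt_wave_norm hx) (fun r hr => hasDerivAt_wave hr.ne')
    (hasDerivAt_waveDeriv (norm_ne_zero_iff.2 hx))]
  ring

end SphericalWave

section Root

/-- Monotonicity of `tan s / s` makes a root of `tan s = β s` the first one. -/
theorem strictMonoOn_tan_div : StrictMonoOn (fun s => Real.tan s / s) (Ioo 0 (Real.pi / 2)) := by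
  have hcos : ∀ s ∈ Ioo 0 (Real.pi / 2), 0 < Real.cos s := fun s hs =>
    Real.cos_pos_of_mem_Ioo ⟨by linarith [hs.1, Real.pi_pos], hs.2⟩
  have hd : ∀ s ∈ Ioo 0 (Real.pi / 2), HasDerivAt (fun s => Real.tan s / s)
      ((1 / Real.cos s ^ 2 * s - Real.tan s * 1) / s ^ 2) s := fun s hs =>
    (Real.hasDerivAt_tan (hcos s hs).ne').div (hasDerivAt_id s) hs.1.ne'
  refine strictMonoOn_of_deriv_pos (convex_Ioo _ _)
    (fun s hs => (hd s hs).continuousAt.continuousWithinAt) fun s hs => ?_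
  rw [interior_Ioo] at hs
  rw [(hd s hs).deriv]
  have hc := hcos s hs
  have h1 : Real.sin s * Real.cos s < s := by
    have := Real.sin_lt hs.1
    have h2 := Real.cos_le_one s
    have h3 := Real.sin_pos_of_pos_of_lt_pi hs.1 (by linarith [hs.2, Real.pi_pos])
    nlinarith
  have h2 : 1 / Real.cos s ^ 2 * s - Real.tan s * 1 =
      (s - Real.sin s * Real.cos s) / Real.cos s ^ 2 := by
    rw [Real.tan_eq_sin_div_cos]; field_simp
  rw [h2]
  exact div_pos (div_pos (by linarith) (by positivity)) (pow_pos hs.1 2)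

/-- The first two Taylor terms of the tangent; they give the upper bound on the eigenvalue. -/
theorem add_cube_le_tan {s : ℝ} (hs : s ∈ Ioo 0 (Real.pi / 2)) : s + s ^ 3 / 3 ≤ Real.tan s := by
  have hcos : ∀ s ∈ Ico 0 (Real.pi / 2), 0 < Real.cos s := fun s hs =>
    Real.cos_pos_of_mem_Ioo ⟨by linarith [hs.1, Real.pi_pos], hs.2⟩
  have hd : ∀ s ∈ Ico 0 (Real.pi / 2), HasDerivAt (fun s => Real.tan s - (s + s ^ 3 / 3))
      (1 / Real.cos s ^ 2 - (1 + s ^ 2)) s := fun s hs => by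
    have h3 : HasDerivAt (fun s : ℝ => s + s ^ 3 / 3) (1 + s ^ 2) s :=
      ((hasDerivAt_id s).add ((hasDerivAt_pow 3 s).div_const 3)).congr_deriv (by
        push_cast; ring)
    exact (Real.hasDerivAt_tan (hcos s hs).ne').sub h3
  have hmono : MonotoneOn (fun s => Real.tan s - (s + s ^ 3 / 3)) (Ico 0 (Real.pi / 2)) := by
    refine monotoneOn_of_deriv_nonneg (convex_Ico _ _)
      (fun s hs => (hd s hs).continuousAt.continuousWithinAt)
      (fun s hs => ((hd s (interior_subset hs)).differentiableAt).differentiableWithinAt)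
      fun s hs => ?_
    rw [(hd s (interior_subset hs)).deriv]
    have hs' := interior_subset hs
    have hc := hcos s hs'
    have ht : s ≤ Real.tan s := Real.le_tan hs'.1 hs'.2
    have e : 1 / Real.cos s ^ 2 = 1 + Real.tan s ^ 2 := by
      rw [Real.tan_eq_sin_div_cos]; field_simp; linarith [Real.sin_sq_add_cos_sq s]
    rw [e]
    nlinarith [hs'.1]
  have := hmono ⟨le_rfl, by positivity⟩ ⟨hs.1.le, hs.2⟩ hs.1.le
  simp at this
  linarith

/-- The first positive root of `tan s = β s`. -/
theorem exists_tan_eq {β : ℝ} (hβ : 1 < β) : ∃ s ∈ Ioo 0 (Real.pi / 2),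
    Real.sin s = β * s * Real.cos s ∧ (∀ t ∈ Ioo 0 s, Real.sin t < β * t * Real.cos t) ∧
      s ^ 2 ≤ 3 * (β - 1) := by
  have hpi := Real.pi_pos
  have hcos : ∀ s ∈ Ioo 0 (Real.pi / 2), 0 < Real.cos s := fun s hs =>
    Real.cos_pos_of_mem_Ioo ⟨by linarith [hs.1], hs.2⟩
  obtain ⟨e, he0, he⟩ : ∃ e ∈ Ioo 0 (Real.pi / 2), Real.sin e ≤ β * e * Real.cos e := by
    -- near `0` the derivative `β - 1` of the difference is positive
    have hd : HasDerivAt (fun s => β * s * Real.cos s - Real.sin s) (β - 1) 0 := by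
      have := (((hasDerivAt_id (0 : ℝ)).const_mul β).mul (Real.hasDerivAt_cos 0)).sub
        (Real.hasDerivAt_sin 0)
      refine this.congr_deriv (by simp)
    have hev := hd.tendsto_slope.eventually (lt_mem_nhds (show 0 < β - 1 by linarith))
    have hev' : ∀ᶠ t in 𝓝[>] (0 : ℝ), 0 < slope (fun s => β * s * Real.cos s - Real.sin s) 0 t :=
      nhdsWithin_mono _ (fun t (ht : 0 < t) => ht.ne') hev
    obtain ⟨t, ht, ht'⟩ := (hev'.and (Ioo_mem_nhdsGT (show (0 : ℝ) < Real.pi / 2 by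
      positivity))).exists
    refine ⟨t, ht', ?_⟩
    rw [slope_def_field] at ht
    simp only [mul_zero, Real.sin_zero, zero_mul, sub_zero] at ht
    have := (div_pos_iff_of_pos_right ht'.1).1 ht
    linarith
  have hcont : ContinuousOn (fun s => Real.sin s - β * s * Real.cos s) (Icc e (Real.pi / 2)) := by
    fun_prop
  obtain ⟨s, hs, hs0⟩ := intermediate_value_Icc he0.2.le hcont
    (show (0 : ℝ) ∈ Icc _ _ from ⟨by simpa using he, by simp⟩)
  have hs1 : s < Real.pi / 2 := by
    refine lt_of_le_of_ne hs.2 fun h => ?_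
    rw [h] at hs0
    simp at hs0
  have hsI : s ∈ Ioo 0 (Real.pi / 2) := ⟨he0.1.trans_le hs.1, hs1⟩
  have hroot : Real.sin s = β * s * Real.cos s := by simpa [sub_eq_zero] using hs0
  have htan : Real.tan s / s = β := by
    have := (hcos s hsI).ne'
    have := hsI.1.ne'
    rw [Real.tan_eq_sin_div_cos, hroot]; field_simp
  refine ⟨s, hsI, hroot, fun t ht => ?_, ?_⟩
  · have htI : t ∈ Ioo 0 (Real.pi / 2) := ⟨ht.1, ht.2.trans hs1⟩
    have h1 := strictMonoOn_tan_div htI hsI ht.2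
    simp only [htan] at h1
    rw [div_lt_iff₀ ht.1, Real.tan_eq_sin_div_cos, div_lt_iff₀ (hcos t htI)] at h1
    exact h1
  · have h1 := add_cube_le_tan hsI
    rw [(div_eq_iff hsI.1.ne').1 htan] at h1
    have : s * (s ^ 2) ≤ s * (3 * (β - 1)) := by nlinarith
    exact le_of_mul_le_mul_left this hsI.1

end Root

end HardSphere

/-! ### The hard-core Neumann ground state -/

namespace HardSphere

open Set Filter

section GroundState

variable {a l lam k : ℝ} {f : R3 → ℝ}

theorem ne_zero_of_le_norm {x : R3} (ha : 0 < a) (hx : a ≤ ‖x‖) : x ≠ 0 :=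
  norm_pos_iff.1 (ha.trans_le hx)

/-- For `lam ≤ k ^ 2` with `k (l - a) < π / 2` a subsolution of `Δ + lam` that is nonpositive on
the boundary of the shell is nonpositive: the supersolution is the spherical wave with a slightly
larger wave number and a slightly smaller core. -/
theorem nonpos_of_subsolution (ha : 0 < a) (hal : a < l) (hk : 0 < k)
    (hkl : k * (l - a) < Real.pi / 2) (hlam : lam ≤ k ^ 2) {h : R3 → ℝ}
    (hc : ContinuousOn h {x | a ≤ ‖x‖ ∧ ‖x‖ ≤ l}) (hd : ∀ x ∈ shell a l, ContDiffAt ℝ 2 h x)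
    (hsub : ∀ x ∈ shell a l, 0 ≤ Laplacian.laplacian h x + lam * h x)
    (hbd : ∀ x, ‖x‖ = a ∨ ‖x‖ = l → h x ≤ 0)
    (x : R3) (hx : a ≤ ‖x‖ ∧ ‖x‖ ≤ l) : h x ≤ 0 := by
  have wpos : ∀ x : R3, a ≤ ‖x‖ → ‖x‖ ≤ l →
      0 < wave 1 (5 / 4 * k) (a - (l - a) / 4) ‖x‖ := by
    intro x h1 h2
    have h0 : 0 < ‖x‖ := ha.trans_le h1
    unfold wave
    rw [one_mul]
    refine div_pos (Real.sin_pos_of_pos_of_lt_pi (mul_pos (by linarith) (by linarith)) ?_) h0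
    have : 5 / 4 * k * (‖x‖ - (a - (l - a) / 4)) ≤ 5 / 4 * k * (5 / 4 * (l - a)) :=
      mul_le_mul_of_nonneg_left (by linarith) (by linarith)
    nlinarith [Real.pi_pos]
  refine nonpos_of_supersolution hc hd hsub hbd
    (w := fun x => wave 1 (5 / 4 * k) (a - (l - a) / 4) ‖x‖)
    (fun x hx =>
      (contDiffAt_wave_norm (ne_zero_of_le_norm ha hx.1)).continuousAt.continuousWithinAt)
    (fun x hx => contDiffAt_wave_norm (ne_zero_of_le_norm ha hx.1.le)) wpos (fun x hx => ?_) x hx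
  rw [laplacian_wave_norm (ne_zero_of_le_norm ha hx.1.le)]
  have := wpos x hx.1.le hx.2.le
  nlinarith [pow_pos hk 2]

/-- The normalization `l / sin(k (l - a))` of the wave with core `a` that is `1` at radius `l`. -/
noncomputable def waveAmp (a l k : ℝ) : ℝ := l / Real.sin (k * (l - a))

theorem sin_pos_of_lt (hal : a < l) (hk : 0 < k) (hkl : k * (l - a) < Real.pi / 2) :
    0 < Real.sin (k * (l - a)) :=
  Real.sin_pos_of_pos_of_lt_pi (mul_pos hk (by linarith)) (by linarith [Real.pi_pos])

theorem wave_outer (ha : 0 < a) (hal : a < l) (hk : 0 < k) (hkl : k * (l - a) < Real.pi / 2) :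
    wave (waveAmp a l k) k a l = 1 := by
  have := (sin_pos_of_lt hal hk hkl).ne'
  have : l ≠ 0 := by linarith
  unfold wave waveAmp
  field_simp

theorem wave_core (c k a : ℝ) : wave c k a a = 0 := by simp [wave]

theorem wave_nonneg (ha : 0 < a) (hal : a < l) (hk : 0 < k) (hkl : k * (l - a) < Real.pi / 2)
    {r : ℝ} (h1 : a ≤ r) (h2 : r ≤ l) : 0 ≤ wave (waveAmp a l k) k a r := by
  have hs := sin_pos_of_lt hal hk hkl
  have : k * (r - a) ≤ k * (l - a) := mul_le_mul_of_nonneg_left (by linarith) hk.le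
  exact div_nonneg (mul_nonneg (div_nonneg (by linarith) hs.le)
    (Real.sin_nonneg_of_nonneg_of_le_pi (mul_nonneg hk.le (by linarith))
      (by linarith [Real.pi_pos]))) (by linarith)

/-- The lower bound comes from concavity of the sine. -/
theorem one_sub_le_wave (ha : 0 < a) (hal : a < l) (hk : 0 < k) (hkl : k * (l - a) < Real.pi / 2)
    {r : ℝ} (h1 : a ≤ r) (h2 : r ≤ l) : 1 - a / r ≤ wave (waveAmp a l k) k a r := by
  have hs := sin_pos_of_lt hal hk hkl
  have hr : 0 < r := ha.trans_le h1
  have hla : 0 < l - a := by linarith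
  have hconc : (r - a) / (l - a) * Real.sin (k * (l - a)) ≤ Real.sin (k * (r - a)) := by
    have hc := strictConcaveOn_sin_Icc.concaveOn.2
      (show (0 : ℝ) ∈ Icc 0 Real.pi from ⟨le_rfl, Real.pi_pos.le⟩)
      (show k * (l - a) ∈ Icc 0 Real.pi from ⟨by positivity, by linarith [Real.pi_pos]⟩)
      (show 0 ≤ 1 - (r - a) / (l - a) by
        rw [sub_nonneg, div_le_one hla]; linarith)
      (show 0 ≤ (r - a) / (l - a) from div_nonneg (by linarith) hla.le) (by ring)
    simp only [smul_eq_mul, mul_zero, Real.sin_zero, zero_add] at hc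
    refine hc.trans_eq ?_
    congr 1
    field_simp
  have e1 : (r - a) / r * 1 ≤ (r - a) / r * (l / (l - a)) :=
    mul_le_mul_of_nonneg_left ((one_le_div hla).2 (by linarith))
      (div_nonneg (by linarith) hr.le)
  calc 1 - a / r = (r - a) / r * 1 := by field_simp
    _ ≤ (r - a) / r * (l / (l - a)) := e1
    _ = l / Real.sin (k * (l - a)) * ((r - a) / (l - a) * Real.sin (k * (l - a))) / r := by
        have := hs.ne'
        generalize Real.sin (k * (l - a)) = S at this
        field_simp
    _ ≤ _ := by
        unfold wave waveAmp
        gcongr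
        exact div_nonneg (by linarith) hs.le

/-- Below the first Neumann wave number the wave increases: its derivative is
`c (k r cos - sin) / r ^ 2`, and the bracket decreases in `r`. -/
theorem wave_le_one (ha : 0 < a) (hal : a < l) (hk : 0 < k) (hkl : k * (l - a) < Real.pi / 2)
    (hN : Real.sin (k * (l - a)) ≤ k * l * Real.cos (k * (l - a))) {r : ℝ} (h1 : a ≤ r)
    (h2 : r ≤ l) : wave (waveAmp a l k) k a r ≤ 1 := by
  have hs := sin_pos_of_lt hal hk hkl
  have hanti : AntitoneOn (fun r => k * r * Real.cos (k * (r - a)) - Real.sin (k * (r - a)))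
      (Icc a l) := by
    have hd : ∀ r, HasDerivAt (fun r => k * r * Real.cos (k * (r - a)) - Real.sin (k * (r - a)))
        (-(k ^ 2 * r * Real.sin (k * (r - a)))) r := fun r =>
      ((((hasDerivAt_id r).const_mul k).mul (hasDerivAt_phase k a r).cos).sub
        (hasDerivAt_phase k a r).sin).congr_deriv (by simp only [id]; ring)
    refine antitoneOn_of_deriv_nonpos (convex_Icc _ _)
      (fun r _ => (hd r).continuousAt.continuousWithinAt)
      (fun r _ => (hd r).differentiableAt.differentiableWithinAt) fun r hr => ?_
    rw [interior_Icc] at hr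
    rw [(hd r).deriv, neg_nonpos]
    have : k * (r - a) ≤ k * (l - a) := mul_le_mul_of_nonneg_left (by linarith [hr.2]) hk.le
    have h3 := Real.sin_nonneg_of_nonneg_of_le_pi (mul_nonneg hk.le (by linarith [hr.1] :
      0 ≤ r - a)) (by linarith [Real.pi_pos])
    have : 0 < r := ha.trans hr.1
    positivity
  have hmono : MonotoneOn (wave (waveAmp a l k) k a) (Icc a l) := by
    refine monotoneOn_of_deriv_nonneg (convex_Icc _ _)
      (fun r hr => (hasDerivAt_wave (by linarith [hr.1])).continuousAt.continuousWithinAt)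
      (fun r hr => (hasDerivAt_wave (by
        rw [interior_Icc] at hr; linarith [hr.1])).differentiableAt.differentiableWithinAt)
      fun r hr => ?_
    rw [interior_Icc] at hr
    rw [(hasDerivAt_wave (by linarith [hr.1])).deriv]
    have h3 := hanti ⟨hr.1.le, hr.2.le⟩ ⟨hal.le, le_rfl⟩ hr.2.le
    simp only at h3
    exact div_nonneg (mul_nonneg (div_nonneg (by linarith) hs.le) (by linarith)) (sq_nonneg _)
  rw [← wave_outer ha hal hk hkl]
  exact hmono ⟨h1, h2⟩ ⟨hal.le, le_rfl⟩ h2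

/-- The spherical wave with Neumann condition at radius `l` is an eigenfunction. -/
theorem isNeumannEigenpair_wave (ha : 0 < a) (hal : a < l) (hk : 0 < k)
    (hkl : k * (l - a) < Real.pi / 2)
    (hN : Real.sin (k * (l - a)) = k * l * Real.cos (k * (l - a))) :
    IsNeumannEigenpair a l (k ^ 2) (fun x => wave (waveAmp a l k) k a (max ‖x‖ a)) := by
  set c := waveAmp a l k
  have hev : ∀ x ∈ shell a l, (fun x : R3 => wave c k a (max ‖x‖ a)) =ᶠ[𝓝 x]
      fun x => wave c k a ‖x‖ := by
    intro x hx
    filter_upwards [(isOpen_shell a l).mem_nhds hx] with y hy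
    rw [max_eq_left hy.1.le]
  constructor
  · refine Continuous.continuousOn ?_
    have : ∀ x : R3, max ‖x‖ a ≠ 0 := fun x => (lt_max_of_lt_right ha).ne'
    unfold wave
    fun_prop (disch := assumption)
  · intro x hx
    exact ((contDiffAt_wave_norm (ne_zero_of_le_norm ha hx.1.le)).congr_of_eventuallyEq
      (hev x hx)).contDiffWithinAt
  · intro x hx
    simp only [max_eq_right hx.le, wave_core]
  · intro x hx
    rw [(InnerProductSpace.laplacian_congr_nhds (hev x hx)).self_of_nhds,
      laplacian_wave_norm (ne_zero_of_le_norm ha hx.1.le), max_eq_left hx.1.le]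
    ring
  · intro x hx
    have hl0 : waveDeriv c k a l = 0 := by simp [waveDeriv, hN]
    have ht : Tendsto (fun y : R3 => waveDeriv c k a ‖y‖) (𝓝[shell a l] x) (𝓝 0) := by
      have h1 : ContinuousAt (waveDeriv c k a) ‖x‖ :=
        (hasDerivAt_waveDeriv (by rw [hx]; linarith)).continuousAt
      have h2 : Tendsto (fun y : R3 => waveDeriv c k a ‖y‖) (𝓝 x) (𝓝 (waveDeriv c k a ‖x‖)) :=
        h1.tendsto.comp continuous_norm.continuousAt.tendsto
      rw [hx, hl0] at h2
      exact h2.mono_left nhdsWithin_le_nhds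
    refine ht.congr' ?_
    filter_upwards [self_mem_nhdsWithin] with y hy
    have hy0 := ne_zero_of_le_norm ha hy.1.le
    have hny : ‖y‖ ≠ 0 := norm_ne_zero_iff.2 hy0
    rw [(hev y hy).fderiv_eq, (hasFDerivAt_radial hy0 (hasDerivAt_wave hny)).fderiv]
    simp
    field_simp
  · obtain ⟨e, he⟩ : ∃ e : R3, ‖e‖ = l := by
      refine ⟨EuclideanSpace.single 0 l, ?_⟩
      simp [abs_of_pos (ha.trans hal)]
    refine ⟨e, by simp [he], ?_⟩
    simp only [he, max_eq_left hal.le, c, wave_outer ha hal hk hkl]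
    exact one_ne_zero

theorem IsNeumannEigenpair.contDiffAt {g : R3 → ℝ} {mu : ℝ} (h : IsNeumannEigenpair a l mu g)
    {x : R3} (hx : x ∈ shell a l) : ContDiffAt ℝ 2 g x :=
  h.contDiffOn.contDiffAt ((isOpen_shell a l).mem_nhds hx)

theorem IsNeumannEigenpair.eq_zero_of_norm_le {g : R3 → ℝ} {mu : ℝ} (ha : 0 < a) (hal : a < l)
    (h : IsNeumannEigenpair a l mu g) {x : R3} (hx : ‖x‖ ≤ a) : g x = 0 := by
  have h1 : EqOn g (fun _ => 0) (Metric.ball (0 : R3) a) := fun y hy =>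
    h.hard_core y (by simpa using hy)
  have h2 : EqOn g (fun _ => 0) (Metric.closedBall (0 : R3) a) :=
    h1.of_subset_closure (h.continuousOn.mono (Metric.closedBall_subset_closedBall hal.le))
      continuousOn_const Metric.ball_subset_closedBall (closure_ball 0 ha.ne').ge
  exact h2 (by simpa using hx)

theorem laplacian_sub_wave {x : R3} {c b κ : ℝ} (hf : ContDiffAt ℝ 2 f x) (hx : x ≠ 0)
    (he : -(Laplacian.laplacian f x) = lam * f x) :
    (Laplacian.laplacian (f - fun y => wave c κ b ‖y‖) : R3 → ℝ) x + lam * (f x - wave c κ b ‖x‖) =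
      (κ ^ 2 - lam) * wave c κ b ‖x‖ := by
  rw [ContDiffAt.laplacian_sub hf (contDiffAt_wave_norm hx), laplacian_wave_norm hx]
  linarith

theorem continuousOn_sub_wave {c b κ : ℝ} (ha : 0 < a)
    (hf : ContinuousOn f (Metric.closedBall (0 : R3) l)) :
    ContinuousOn (f - fun y => wave c κ b ‖y‖) {x | a ≤ ‖x‖ ∧ ‖x‖ ≤ l} :=
  (hf.mono fun x hx => by simpa using hx.2).sub fun x hx =>
    (contDiffAt_wave_norm (ne_zero_of_le_norm ha hx.1)).continuousAt.continuousWithinAt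

/-- The smallest eigenvalue is not below the first radial one: otherwise a radial wave with an
eigenvalue in between lies above `f`, agrees with it on the sphere `|x| = l`, and has positive
radial derivative there, against the Neumann condition. -/
theorem sq_le_of_isNeumannEigenpair (ha : 0 < a) (hal : a < l) (hk : 0 < k)
    (hkl : k * (l - a) < Real.pi / 2)
    (hN : ∀ t, 0 < t → t < k → Real.sin (t * (l - a)) < t * l * Real.cos (t * (l - a)))
    (h : IsNeumannEigenpair a l lam f) (h1 : ∀ x : R3, ‖x‖ = l → f x = 1) : k ^ 2 ≤ lam := by
  by_contra! hlt
  obtain ⟨κ, hκ0, hκk, hκ⟩ : ∃ κ, 0 < κ ∧ κ < k ∧ lam < κ ^ 2 := by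
    refine ⟨Real.sqrt ((max lam 0 + k ^ 2) / 2), ?_, ?_, ?_⟩
    · exact Real.sqrt_pos.2 (by have := le_max_right lam 0; positivity)
    · rw [Real.sqrt_lt' hk]
      have : max lam 0 < k ^ 2 := max_lt hlt (by positivity)
      linarith
    · rw [Real.sq_sqrt (by have := le_max_right lam 0; positivity)]
      have : max lam 0 < k ^ 2 := max_lt hlt (by positivity)
      linarith [le_max_left lam 0]
  have hκl : κ * (l - a) < Real.pi / 2 :=
    lt_of_le_of_lt (mul_le_mul_of_nonneg_right hκk.le (by linarith)) hkl
  set c := waveAmp a l κ with hc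
  have hle : ∀ x : R3, a ≤ ‖x‖ ∧ ‖x‖ ≤ l → f x - wave c κ a ‖x‖ ≤ 0 := by
    refine nonpos_of_subsolution ha hal hκ0 hκl hκ.le (continuousOn_sub_wave ha h.continuousOn)
      (fun x hx => (h.contDiffAt hx).sub (contDiffAt_wave_norm (ne_zero_of_le_norm ha hx.1.le)))
      (fun x hx => ?_) fun x hx => ?_
    · exact (laplacian_sub_wave (h.contDiffAt hx) (ne_zero_of_le_norm ha hx.1.le)
        (h.eigen x hx)).ge.trans' (mul_nonneg (by linarith)
          (wave_nonneg ha hal hκ0 hκl hx.1.le hx.2.le))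
    · rcases hx with hx | hx
      · simp only [h.eq_zero_of_norm_le ha hal hx.le, hx, wave_core]; simp
      · simp only [h1 x hx, hx, hc, wave_outer ha hal hκ0 hκl]; simp
  set e : R3 := EuclideanSpace.single 0 1 with he
  have hen : ‖e‖ = 1 := by simp [he]
  have hnorm : ∀ t : ℝ, 0 < t → ‖t • e‖ = t := fun t ht => by
    rw [norm_smul, hen, mul_one, Real.norm_of_nonneg ht.le]
  have hl : 0 < l := ha.trans hal
  set D : ℝ → ℝ := fun t => f (t • e) - wave c κ a t with hD
  have hshell : ∀ t ∈ Ioo a l, t • e ∈ shell a l := fun t ht => by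
    have := hnorm t (ha.trans ht.1)
    exact ⟨by rw [this]; exact ht.1, by rw [this]; exact ht.2⟩
  have hDd : ∀ t ∈ Ioo a l, HasDerivAt D (fderiv ℝ f (t • e) e - waveDeriv c κ a t) t := by
    intro t ht
    have hline : HasDerivAt (fun t : ℝ => t • e) e t := by
      simpa using (hasDerivAt_id t).smul_const e
    exact (((h.contDiffAt (hshell t ht)).differentiableAt (by simp)).hasFDerivAt.comp_hasDerivAt t
      hline).sub (hasDerivAt_wave (by linarith [ht.1]))
  have hpos : 0 < waveDeriv c κ a l := by
    have := hN κ hκ0 hκk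
    have hs := sin_pos_of_lt hal hκ0 hκl
    exact div_pos (mul_pos (div_pos hl hs) (by linarith)) (by positivity)
  have hlim : Tendsto (fun t => fderiv ℝ f (t • e) e - waveDeriv c κ a t) (𝓝[<] l)
      (𝓝 (0 - waveDeriv c κ a l)) := by
    refine Tendsto.sub ?_ ((hasDerivAt_waveDeriv hl.ne').continuousAt.tendsto.mono_left
      nhdsWithin_le_nhds)
    have hin : ∀ᶠ t in 𝓝[<] l, t ∈ Ioo a l := Ioo_mem_nhdsLT hal
    have hto : Tendsto (fun t : ℝ => t • e) (𝓝[<] l) (𝓝[shell a l] (l • e)) := by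
      refine tendsto_nhdsWithin_iff.2 ⟨?_, hin.mono hshell⟩
      exact ((continuous_id.smul continuous_const).tendsto l).mono_left nhdsWithin_le_nhds
    refine ((h.neumann (l • e) (hnorm l hl)).comp hto).congr' ?_
    filter_upwards [hin] with t ht
    have ht0 := ha.trans ht.1
    simp only [Function.comp_apply]
    rw [hnorm t ht0, inv_smul_smul₀ ht0.ne']
  have hneg : ∀ᶠ t in 𝓝[<] l, fderiv ℝ f (t • e) e - waveDeriv c κ a t < 0 :=
    hlim.eventually (gt_mem_nhds (by linarith))
  obtain ⟨t₀, ht₀, hsubset⟩ := (mem_nhdsLT_iff_exists_Ioo_subset' hal).1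
    (hneg.and (Ioo_mem_nhdsLT hal))
  have hanti : StrictAntiOn D (Icc ((t₀ + l) / 2) l) := by
    have ht₀l : t₀ < l := ht₀
    refine strictAntiOn_of_deriv_neg (convex_Icc _ _) ?_ fun t ht => ?_
    · intro t ht
      rcases eq_or_lt_of_le ht.2 with rfl | htl
      · have h2 : ContinuousOn (fun s : ℝ => f (s • e)) (Icc ((t₀ + t) / 2) t) := by
          refine h.continuousOn.comp (by fun_prop) fun s hs => ?_
          have h3 : a < s := (hsubset (show (t₀ + t) / 2 ∈ Ioo t₀ t from
            ⟨by linarith, by linarith⟩)).2.1.trans_le hs.1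
          simp [hnorm s (ha.trans h3), hs.2]
        exact (h2 t ht).sub (hasDerivAt_wave hl.ne').continuousAt.continuousWithinAt
      · exact (hDd t (hsubset ⟨by linarith [ht.1], htl⟩).2).continuousAt.continuousWithinAt
    · rw [interior_Icc] at ht
      have := hsubset (show t ∈ Ioo t₀ l from ⟨by linarith [ht.1], ht.2⟩)
      rw [(hDd t this.2).deriv]
      exact this.1
  have ht₀l : t₀ < l := ht₀
  have hm := (hsubset (show (t₀ + l) / 2 ∈ Ioo t₀ l from ⟨by linarith, by linarith⟩)).2
  have hcmp := hanti ⟨le_rfl, hm.2.le⟩ ⟨hm.2.le, le_rfl⟩ hm.2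
  have hDl : D l = 0 := by
    simp only [hD, h1 _ (hnorm l hl), hc, wave_outer ha hal hκ0 hκl, sub_self]
  have hDm := hle (((t₀ + l) / 2) • e) (by
    rw [hnorm _ (ha.trans hm.1)]; exact ⟨hm.1.le, hm.2.le⟩)
  rw [hnorm _ (ha.trans hm.1)] at hDm
  rw [hDl] at hcmp
  exact absurd hDm (not_le.2 hcmp)

/-- The ground state is the explicit spherical wave. -/
theorem IsNeumannGroundState.exists_eq_wave (ha : 0 < a) (hal : a < l)
    (h : IsNeumannGroundState a l lam f) :
    ∃ k, 0 < k ∧ k * (l - a) < Real.pi / 2 ∧ lam = k ^ 2 ∧ lam ≤ 3 * a / (l - a) ^ 3 ∧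
      Real.sin (k * (l - a)) = k * l * Real.cos (k * (l - a)) ∧
      ∀ x : R3, f x = if ‖x‖ ≤ a then 0 else if ‖x‖ ≤ l then wave (waveAmp a l k) k a ‖x‖
        else 1 := by
  have hla : 0 < l - a := by linarith
  obtain ⟨s, hs, hroot, hfirst, hsq⟩ := exists_tan_eq ((one_lt_div hla).2 (by linarith : l - a < l))
  set k := s / (l - a) with hkdef
  have hks : k * (l - a) = s := by rw [hkdef]; field_simp
  have hk : 0 < k := div_pos hs.1 hla
  have hkl : k * (l - a) < Real.pi / 2 := hks ▸ hs.2
  have hN : Real.sin (k * (l - a)) = k * l * Real.cos (k * (l - a)) := by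
    rw [hks, hroot, hkdef]; ring
  have hlam : lam = k ^ 2 := by
    refine le_antisymm (h.smallest _ _ (isNeumannEigenpair_wave ha hal hk hkl hN))
      (sq_le_of_isNeumannEigenpair ha hal hk hkl (fun t ht0 htk => ?_) h.eigenpair
        fun x hx => h.eq_one x hx.ge)
    have := hfirst (t * (l - a)) ⟨by positivity, by rw [← hks]; gcongr⟩
    refine this.trans_eq ?_
    field_simp
  have hh := h.eigenpair
  have hbd : ∀ x : R3, ‖x‖ = a ∨ ‖x‖ = l → f x - wave (waveAmp a l k) k a ‖x‖ = 0 := by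
    rintro x (hx | hx)
    · simp only [hh.eq_zero_of_norm_le ha hal hx.le, hx, wave_core]; simp
    · simp only [h.eq_one x hx.ge, hx, wave_outer ha hal hk hkl]; simp
  have hcont := continuousOn_sub_wave (c := waveAmp a l k) (b := a) (κ := k) ha hh.continuousOn
  have hC2 : ∀ x ∈ shell a l, ContDiffAt ℝ 2 (f - fun y => wave (waveAmp a l k) k a ‖y‖) x :=
    fun x hx => (hh.contDiffAt hx).sub (contDiffAt_wave_norm (ne_zero_of_le_norm ha hx.1.le))
  have heq : ∀ x ∈ shell a l,
      (Laplacian.laplacian (f - fun y => wave (waveAmp a l k) k a ‖y‖) : R3 → ℝ) x +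
        lam * (f x - wave (waveAmp a l k) k a ‖x‖) = 0 := fun x hx => by
    rw [laplacian_sub_wave (hh.contDiffAt hx) (ne_zero_of_le_norm ha hx.1.le) (hh.eigen x hx),
      hlam, sub_self, zero_mul]
  have hle := nonpos_of_subsolution ha hal hk hkl hlam.le hcont hC2 (fun x hx => (heq x hx).ge)
    fun x hx => (hbd x hx).le
  have hge := nonpos_of_subsolution ha hal hk hkl hlam.le (h := -(f - fun y =>
    wave (waveAmp a l k) k a ‖y‖)) hcont.neg (fun x hx => (hC2 x hx).neg) (fun x hx => by
      rw [InnerProductSpace.laplacian_neg]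
      have := heq x hx
      simp only [Pi.neg_apply, Pi.sub_apply]
      linarith) fun x hx => by
      have := hbd x hx
      simp only [Pi.neg_apply, Pi.sub_apply]
      linarith
  refine ⟨k, hk, hkl, hlam, ?_, hN, fun x => ?_⟩
  · have e : l / (l - a) - 1 = a / (l - a) := by field_simp; ring
    rw [e] at hsq
    rw [hlam, hkdef, div_pow, div_le_div_iff₀ (by positivity) (by positivity)]
    have e2 : 3 * (a / (l - a)) * (l - a) = 3 * a := by field_simp
    have : s ^ 2 * (l - a) ≤ 3 * a := e2 ▸ mul_le_mul_of_nonneg_right hsq hla.le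
    nlinarith [pow_pos hla 2]
  · split_ifs with h1 h2
    · exact hh.eq_zero_of_norm_le ha hal h1
    · have h3 := hle x ⟨(not_le.1 h1).le, h2⟩
      have h4 := hge x ⟨(not_le.1 h1).le, h2⟩
      simp only [Pi.neg_apply, Pi.sub_apply] at h3 h4
      linarith
    · exact h.eq_one x (not_le.1 h2).le

/-- The properties of the ground state on which the energy estimate rests. -/
theorem IsNeumannGroundState.bounds (ha : 0 < a) (hal : a < l)
    (h : IsNeumannGroundState a l lam f) :
    0 < lam ∧ lam ≤ 3 * a / (l - a) ^ 3 ∧ Measurable f ∧ (∀ x y, ‖x‖ = ‖y‖ → f x = f y) ∧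
      (∀ x, 0 ≤ f x) ∧ (∀ x, f x ≤ 1) ∧ ∀ x, x ≠ 0 → 1 - a / ‖x‖ ≤ f x := by
  obtain ⟨k, hk, hkl, hlam, hub, hN, hf⟩ := h.exists_eq_wave ha hal
  refine ⟨hlam ▸ by positivity, hub, ?_, fun x y hxy => by rw [hf x, hf y, hxy],
    fun x => ?_, fun x => ?_, fun x hx => ?_⟩
  · have : f = fun x => if ‖x‖ ≤ a then 0 else if ‖x‖ ≤ l then
        wave (waveAmp a l k) k a ‖x‖ else 1 := funext hf
    rw [this]
    refine Measurable.ite (measurableSet_le measurable_norm measurable_const) measurable_const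
      (Measurable.ite (measurableSet_le measurable_norm measurable_const) ?_ measurable_const)
    unfold wave
    fun_prop
  all_goals rw [hf x]; split_ifs with h1 h2
  · exact le_rfl
  · exact wave_nonneg ha hal hk hkl (not_le.1 h1).le h2
  · exact zero_le_one
  · exact zero_le_one
  · exact wave_le_one ha hal hk hkl hN.le (not_le.1 h1).le h2
  · exact le_rfl
  · rw [sub_nonpos, one_le_div (norm_pos_iff.2 hx)]
    exact h1
  · exact one_sub_le_wave ha hal hk hkl (not_le.1 h1).le h2
  · have : 0 ≤ a / ‖x‖ := by positivity
    linarith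

end GroundState

end HardSphere

/-! ### Integrals over the torus and over balls -/

namespace HardSphere

open MeasureTheory Set Filter

section Torus

variable {L : ℝ}

theorem pi_smul {ι X : Type*} [Fintype ι] [MeasurableSpace X] (c : ENNReal) (hc : c ≠ ⊤)
    (μ : Measure X) [IsFiniteMeasure μ] :
    Measure.pi (fun _ : ι => c • μ) = c ^ Fintype.card ι • Measure.pi (fun _ => μ) := by
  have : IsFiniteMeasure (c • μ) := μ.smul_finite hc
  refine Measure.pi_eq fun s _ => ?_
  simp [Finset.prod_mul_distrib]

/-- The representative of a point of `ℝ / L ℤ` in `[-L/2, L/2)`; the function that rounds to a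
multiple of `L` makes sense, and is periodic, for every `L`. -/
noncomputable def circleRep (L : ℝ) (t : AddCircle L) : ℝ :=
  Function.Periodic.lift (f := fun t : ℝ => t - L * (round (t / L) : ℝ)) (c := L) (by
    intro t
    rcases eq_or_ne L 0 with rfl | hL
    · simp
    · simp only [add_div, div_self hL, round_add_one]; push_cast; ring) t

theorem circleRep_coe (L t : ℝ) : circleRep L (t : AddCircle L) = t - L * (round (t / L) : ℝ) :=
  rfl

theorem abs_circleRep (t : AddCircle L) : |circleRep L t| = ‖t‖ := by
  induction t using QuotientAddGroup.induction_on with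
  | H t => rw [circleRep_coe, AddCircle.norm_eq, div_eq_inv_mul, mul_comm L]

/-- The torus `(ℝ / L ℤ)³`. -/
abbrev Torus (L : ℝ) : Type := Fin 3 → AddCircle L

/-- The projection of space onto the torus. -/
def toTorus (L : ℝ) (x : R3) : Torus L := fun k => (x k : AddCircle L)

/-- The representative of a point of the torus in the cube `[-L/2, L/2)³`. -/
noncomputable def torusLift (L : ℝ) (y : Torus L) : R3 := WithLp.toLp 2 fun k => circleRep L (y k)

theorem torusLift_toTorus (L : ℝ) (x : R3) : torusLift L (toTorus L x) = torusRep L x := rfl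

theorem norm_torusLift_neg (y : Torus L) : ‖torusLift L (-y)‖ = ‖torusLift L y‖ := by
  simp [EuclideanSpace.norm_eq, torusLift, abs_circleRep]

variable [hL : Fact (0 < L)]

theorem measurable_circleRep : Measurable (circleRep L) := by
  have h : circleRep L = (fun t : ℝ => t - L * (round (t / L) : ℝ)) ∘ Subtype.val ∘
      (AddCircle.measurableEquivIoc L 0) := by
    funext t
    have := (AddCircle.measurableEquivIoc L 0).symm_apply_apply t
    conv_lhs => rw [← this]
    rfl
  rw [h]
  have hr : Measurable fun t : ℝ => (round (t / L) : ℝ) := by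
    simp_rw [round_eq]
    fun_prop
  exact (measurable_id.sub (hr.const_mul L)).comp
    (measurable_subtype_coe.comp (AddCircle.measurableEquivIoc L 0).measurable)

theorem measurable_torusLift : Measurable (torusLift L) := by
  refine (WithLp.measurable_toLp 2 _).comp (measurable_pi_iff.2 fun k => ?_)
  exact measurable_circleRep.comp (measurable_pi_apply k)

/-- The normalized invariant measure of the torus. -/
noncomputable def torusMeasure (L : ℝ) [Fact (0 < L)] : Measure (Torus L) :=
  Measure.pi fun _ => AddCircle.haarAddCircle

instance : IsProbabilityMeasure (torusMeasure L) := by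
  unfold torusMeasure; infer_instance

instance : (torusMeasure L).IsAddLeftInvariant := by
  unfold torusMeasure; infer_instance

/-- The closed cube of side length `L`. -/
def cube (L : ℝ) : Set R3 := {x | ∀ k, x k ∈ Icc (-L / 2) (L / 2)}

theorem measurePreserving_toTorus :
    MeasurePreserving (toTorus L) (volume.restrict (cube L))
      (ENNReal.ofReal L ^ 3 • torusMeasure L) := by
  have h1 : MeasurePreserving (fun t : ℝ => (t : AddCircle L))
      (volume.restrict (Icc (-L / 2) (L / 2))) (ENNReal.ofReal L • AddCircle.haarAddCircle) := by
    have := AddCircle.measurePreserving_mk L (-L / 2)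
    rw [show -L / 2 + L = L / 2 by ring, Measure.restrict_congr_set Ioc_ae_eq_Icc,
      AddCircle.volume_eq_smul_haarAddCircle] at this
    exact this
  have : IsFiniteMeasure (ENNReal.ofReal L • (AddCircle.haarAddCircle : Measure (AddCircle L))) :=
    Measure.smul_finite _ ENNReal.ofReal_ne_top
  have h2 := measurePreserving_pi (fun _ : Fin 3 => volume.restrict (Icc (-L / 2) (L / 2)))
    (fun _ => ENNReal.ofReal L • AddCircle.haarAddCircle) fun _ => h1
  rw [pi_smul _ ENNReal.ofReal_ne_top, ← Measure.restrict_pi_pi, Fintype.card_fin] at h2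
  have h3 := (PiLp.volume_preserving_ofLp (Fin 3)).restrict_preimage
    (s := univ.pi fun _ => Icc (-L / 2) (L / 2)) (MeasurableSet.univ_pi fun _ => measurableSet_Icc)
  have h4 : (@WithLp.ofLp 2 (Fin 3 → ℝ)) ⁻¹' (univ.pi fun _ => Icc (-L / 2) (L / 2)) = cube L := by
    ext x; simp only [cube, mem_preimage, mem_univ_pi, mem_ofPred_eq]
  rw [h4] at h3
  exact h2.comp h3

/-- Integrals of periodic functions over the box are integrals over the torus. -/
theorem integral_box {N : ℕ} {Φ : (Fin N → Torus L) → ℝ} (hΦ : Measurable Φ) :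
    ∫ x in box N L, Φ (fun i => toTorus L (x i)) =
      (L ^ 3) ^ N * ∫ y, Φ y ∂(Measure.pi fun _ => torusMeasure L) := by
  have : IsFiniteMeasure (ENNReal.ofReal L ^ 3 • torusMeasure L) :=
    Measure.smul_finite _ (ENNReal.pow_ne_top ENNReal.ofReal_ne_top)
  have h := measurePreserving_pi (fun _ : Fin N => volume.restrict (cube L))
    (fun _ => ENNReal.ofReal L ^ 3 • torusMeasure L) fun _ => measurePreserving_toTorus
  rw [pi_smul _ (ENNReal.pow_ne_top ENNReal.ofReal_ne_top), ← Measure.restrict_pi_pi,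
    Fintype.card_fin] at h
  have hbox : box N L = univ.pi fun _ => cube L := by ext x; simp [box, cube]
  have hi := integral_map
    (μ := (Measure.pi fun _ => volume).restrict (univ.pi fun _ : Fin N => cube L)) (f := Φ)
    h.measurable.aemeasurable
    hΦ.stronglyMeasurable.aestronglyMeasurable
  rw [h.map_eq, integral_smul_measure] at hi
  rw [hbox, volume_pi, ← hi]
  simp [ENNReal.toReal_ofReal hL.out.le]

/-- `torusRep` moves only points on the boundary of the cube. -/
theorem torusRep_ae_eq : ∀ᵐ x ∂(volume.restrict (cube L)), torusRep L x = x := by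
  have hL0 := hL.out
  have h1 : (univ.pi fun _ : Fin 3 => Ico (-L / 2) (L / 2)) =ᵐ[volume]
      univ.pi fun _ : Fin 3 => Icc (-L / 2) (L / 2) := by
    have := Measure.univ_pi_Ico_ae_eq_Icc (μ := fun _ : Fin 3 => (volume : Measure ℝ))
      (f := fun _ => -L / 2) (g := fun _ => L / 2)
    rwa [← pi_univ_Icc] at this
  have h2 := (PiLp.volume_preserving_ofLp (Fin 3)).quasiMeasurePreserving.preimage_ae_eq h1
  have h4 : (@WithLp.ofLp 2 (Fin 3 → ℝ)) ⁻¹' (univ.pi fun _ => Icc (-L / 2) (L / 2)) = cube L := by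
    ext x; simp only [cube, mem_preimage, mem_univ_pi, mem_ofPred_eq]
  rw [h4] at h2
  rw [← Measure.restrict_congr_set h2]
  refine (ae_restrict_iff' ((PiLp.volume_preserving_ofLp (Fin 3)).measurable
    (MeasurableSet.univ_pi fun _ => measurableSet_Ico))).2 (ae_of_all _ fun x hx => ?_)
  ext k
  have hk : x k ∈ Ico (-L / 2) (L / 2) := hx k (mem_univ k)
  have hr : round (x k / L) = 0 := by
    rw [round_eq_zero_iff]
    constructor
    · rw [le_div_iff₀ hL0]; linarith [hk.1]
    · rw [div_lt_iff₀ hL0]; linarith [hk.2]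
  simp [torusRep, hr]

/-- Integrals over the torus are dominated by integrals over space. -/
theorem integral_torusLift_le {g G : R3 → ℝ} (hg : Measurable g) (hg0 : ∀ x, 0 ≤ g x)
    (hG : Integrable G) (hgG : ∀ x, x ≠ 0 → g x ≤ G x) (hG0 : ∀ x, 0 ≤ G x) :
    ∫ y, g (torusLift L y) ∂(torusMeasure L) ≤ (∫ x, G x) / L ^ 3 := by
  have hL0 := hL.out
  rw [le_div_iff₀ (by positivity)]
  have h := measurePreserving_toTorus (L := L)
  have hi := integral_map (μ := volume.restrict (cube L)) (f := fun y => g (torusLift L y))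
    h.measurable.aemeasurable
    (hg.comp measurable_torusLift).stronglyMeasurable.aestronglyMeasurable
  rw [h.map_eq, integral_smul_measure] at hi
  simp only [ENNReal.toReal_pow, ENNReal.toReal_ofReal hL0.le, smul_eq_mul,
    torusLift_toTorus] at hi
  rw [mul_comm, hi]
  calc ∫ x in cube L, g (torusRep L x) = ∫ x in cube L, g x :=
        integral_congr_ae (torusRep_ae_eq.mono fun x hx => by simp only [hx])
    _ ≤ ∫ x in cube L, G x := by
        refine integral_mono_of_nonneg (ae_of_all _ hg0) hG.integrableOn ?_
        filter_upwards [ae_restrict_of_ae (compl_mem_ae_iff.2 (measure_singleton (0 : R3)))]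
          with x hx using hgG x hx
    _ ≤ ∫ x, G x := setIntegral_le_integral hG (ae_of_all _ hG0)

end Torus

section Radial

/-- The integral of `|x| ^ (-j)` over a ball, for `j ≤ 2`. -/
theorem integral_ball_inv_pow {l : ℝ} (hl : 0 < l) (j : ℕ) (hj : j ≤ 2) :
    Integrable ((Metric.closedBall (0 : R3) l).indicator fun x => (‖x‖ ^ j)⁻¹) ∧
    ∫ x, (Metric.closedBall (0 : R3) l).indicator (fun x => (‖x‖ ^ j)⁻¹) x =
      4 * Real.pi * (l ^ (3 - j) / (3 - j : ℕ)) := by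
  set F : ℝ → ℝ := (Iic l).indicator fun r => (r ^ j)⁻¹ with hF
  have h0 : ((Metric.closedBall (0 : R3) l).indicator fun x => (‖x‖ ^ j)⁻¹) =
      fun x => F ‖x‖ := by
    funext x
    by_cases hx : ‖x‖ ≤ l <;> simp [hF, indicator, hx]
  have hdim : Module.finrank ℝ R3 = 3 := by simp
  have hprod : EqOn (fun r : ℝ => r ^ (3 - 1) • F r) ((Iic l).indicator fun r => r ^ (2 - j))
      (Ioi 0) := by
    intro r (hr : 0 < r)
    by_cases hrl : r ≤ l
    · simp only [hF, indicator, mem_Iic, hrl, if_true, smul_eq_mul]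
      rw [← div_eq_mul_inv, div_eq_iff (by positivity), ← pow_add]
      congr 1; omega
    · simp [hF, indicator, hrl]
  have hind : ∀ s : Set ℝ, s = Ioi 0 → s ∩ Iic l = Ioc 0 l := by
    rintro s rfl; exact Ioi_inter_Iic
  have hint : IntegrableOn (fun r : ℝ => r ^ (3 - 1) • F r) (Ioi 0) := by
    rw [integrableOn_congr_fun hprod measurableSet_Ioi, IntegrableOn,
      integrable_indicator_iff measurableSet_Iic, IntegrableOn,
      Measure.restrict_restrict measurableSet_Iic, Iic_inter_Ioi]
    exact ((continuous_pow (2 - j)).integrableOn_Icc (a := 0) (b := l)).mono_set Ioc_subset_Icc_self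
  rw [h0]
  constructor
  · rw [← hdim] at hint
    exact (integrable_fun_norm_addHaar volume).2 hint
  · rw [integral_fun_norm_addHaar volume F, hdim, setIntegral_congr_fun measurableSet_Ioi hprod,
      setIntegral_indicator measurableSet_Iic, Ioi_inter_Iic,
      ← intervalIntegral.integral_of_le hl.le, integral_pow, Measure.real,
      EuclideanSpace.volume_ball_fin_three]
    have e : 2 - j + 1 = 3 - j := by omega
    have hz : (0 : ℝ) ^ (3 - j) = 0 := zero_pow (by omega)
    have e2 : ((2 - j : ℕ) : ℝ) + 1 = ((3 - j : ℕ) : ℝ) := by exact_mod_cast e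
    simp only [e, e2, hz, ENNReal.ofReal_one, one_pow, one_mul, smul_eq_mul, sub_zero, nsmul_eq_mul]
    rw [ENNReal.toReal_ofReal (by positivity)]
    push_cast
    ring

end Radial

end HardSphere

/-! ### The energy estimate -/

namespace HardSphere

open MeasureTheory Set Filter

section Estimate

variable {a l lam L : ℝ} {f : R3 → ℝ}

/-- On the torus of side length `L`, the square of the ground state is a pair weight with
`∫ (1 - f²) = O(a l² / L³)` and `∫ (1 - f²)² = O(a² l / L³)`. -/
theorem IsNeumannGroundState.isConvWeight [hL : Fact (0 < L)] (ha : 0 < a) (hal : a < l)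
    (h : IsNeumannGroundState a l lam f) :
    IsConvWeight (torusMeasure L) (fun y => f (torusLift L y) ^ 2)
      (4 * Real.pi * a * l ^ 2 / L ^ 3) (16 * Real.pi * a ^ 2 * l / L ^ 3) := by
  obtain ⟨-, -, hmeas, hrad, h0, h1, hlow⟩ := h.bounds ha hal
  have hl : 0 < l := ha.trans hal
  have hu : ∀ x, x ≠ 0 → 1 - f x ^ 2 ≤
      2 * a * (Metric.closedBall (0 : R3) l).indicator (fun x => (‖x‖ ^ 1)⁻¹) x := by
    intro x hx
    by_cases hxl : ‖x‖ ≤ l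
    · rw [indicator_of_mem (by simpa using hxl), pow_one, ← div_eq_mul_inv, mul_div_assoc]
      nlinarith [h0 x, h1 x, hlow x hx]
    · rw [h.eq_one x (not_le.1 hxl).le, indicator_of_notMem (by simpa using hxl)]
      simp
  have hf2 : ∀ x, f x ^ 2 ≤ 1 := fun x => pow_le_one₀ (h0 x) (h1 x)
  obtain ⟨i1, e1⟩ := integral_ball_inv_pow hl 1 (by norm_num)
  obtain ⟨i2, e2⟩ := integral_ball_inv_pow hl 2 le_rfl
  have hind : ∀ (j : ℕ) (x : R3),
      0 ≤ (Metric.closedBall (0 : R3) l).indicator (fun x => (‖x‖ ^ j)⁻¹) x :=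
    fun j x => indicator_nonneg (fun x _ => by positivity) x
  refine ⟨(hmeas.comp measurable_torusLift).pow_const 2, fun y => ?_, fun y => sq_nonneg _,
    fun y => hf2 _, ?_, ?_⟩
  · rw [hrad _ _ (norm_torusLift_neg y)]
  · refine (integral_torusLift_le (L := L) (g := fun x => 1 - f x ^ 2)
      ((hmeas.pow_const 2).const_sub 1) (fun x => sub_nonneg.2 (hf2 x)) (i1.const_mul (2 * a)) hu
      fun x => mul_nonneg (by positivity) (hind 1 x)).trans_eq ?_
    rw [integral_const_mul, e1]
    norm_num
    ring
  · refine (integral_torusLift_le (L := L) (g := fun x => (1 - f x ^ 2) ^ 2)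
      (((hmeas.pow_const 2).const_sub 1).pow_const 2) (fun x => sq_nonneg _)
      (i2.const_mul (4 * a ^ 2)) (fun x hx => ?_)
      fun x => mul_nonneg (by positivity) (hind 2 x)).trans_eq ?_
    · refine (pow_le_pow_left₀ (sub_nonneg.2 (hf2 x)) (hu x hx) 2).trans_eq ?_
      by_cases hxl : ‖x‖ ≤ l
      · rw [indicator_of_mem (by simpa using hxl), indicator_of_mem (by simpa using hxl)]
        ring
      · rw [indicator_of_notMem (by simpa using hxl), indicator_of_notMem (by simpa using hxl)]
        ring
    · rw [integral_const_mul, e2]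
      norm_num
      ring

theorem potential_nonneg (hlam : 0 ≤ lam) (l : ℝ) (x : R3) : 0 ≤ potential l lam x :=
  mul_nonneg (by linarith) (indicator_nonneg (fun _ _ => zero_le_one) x)

theorem potential_eq_of_norm_eq (l lam : ℝ) {x y : R3} (h : ‖x‖ = ‖y‖) :
    potential l lam x = potential l lam y := by
  simp [potential, indicator, h]

theorem bddMeas_potential (l lam : ℝ) : BddMeas (potential l lam) := by
  refine (BddMeas.const (2 * lam)).mul (.of_mem_Icc
    (measurable_const.indicator Metric.isClosed_closedBall.measurableSet)
    (fun x => indicator_nonneg (fun _ _ => zero_le_one) x)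
    fun x => indicator_le_self' (fun _ _ => zero_le_one) x)

/-- The normalized two-body integral of `V f²` is at most `8πa / L³`, up to a factor
`(1 - a / l)⁻³`. -/
theorem IsNeumannGroundState.integral_potential_le [hL : Fact (0 < L)] (ha : 0 < a) (hal : a < l)
    (h : IsNeumannGroundState a l lam f) :
    ∫ y, potential l lam (torusLift L y) * f (torusLift L y) ^ 2 ∂(torusMeasure L) ≤
      8 * Real.pi * a * (l / (l - a)) ^ 3 / L ^ 3 := by
  obtain ⟨hlam, hub, hmeas, -, h0, h1, -⟩ := h.bounds ha hal
  have hl : 0 < l := ha.trans hal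
  have hla : 0 < l - a := by linarith
  have hL0 := hL.out
  obtain ⟨i0, e0⟩ := integral_ball_inv_pow hl 0 (by norm_num)
  have hp : ∀ x, potential l lam x =
      2 * lam * (Metric.closedBall (0 : R3) l).indicator (fun x => (‖x‖ ^ 0)⁻¹) x := by
    simp [potential]
  refine (integral_torusLift_le (L := L) (g := fun x => potential l lam x * f x ^ 2)
    ((bddMeas_potential l lam).meas.mul (hmeas.pow_const 2))
    (fun x => mul_nonneg (potential_nonneg hlam.le l x) (sq_nonneg _)) (i0.const_mul (2 * lam))
    (fun x _ => ?_) fun x => ?_).trans ?_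
  · rw [← hp]
    exact mul_le_of_le_one_right (potential_nonneg hlam.le l x) (pow_le_one₀ (h0 x) (h1 x))
  · rw [← hp]; exact potential_nonneg hlam.le l x
  · rw [integral_const_mul, e0]
    refine div_le_div_of_nonneg_right ?_ (by positivity)
    calc 2 * lam * (4 * Real.pi * (l ^ (3 - 0) / ((3 - 0 : ℕ) : ℝ)))
        = lam * (8 / 3 * Real.pi * l ^ 3) := by push_cast; ring
      _ ≤ 3 * a / (l - a) ^ 3 * (8 / 3 * Real.pi * l ^ 3) := by gcongr
      _ = _ := by rw [div_pow]; ring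

/-- The arithmetic of the thermodynamic limit: a pair expectation `X` close to `8πa / V` in a
volume `V = N / rho` gives an energy per particle close to `4πa rho`. -/
theorem half_mul_le_energy {N V rho t s X : ℝ} (ha : 0 < a) (hrho : 0 < rho) (hV : 0 < V)
    (hN : N = rho * V) (hatl : a = t * l) (ht0 : 0 < t) (ht4 : t ≤ 1 / 4) (hs0 : 0 ≤ s)
    (hs : s ≤ t / 2)
    (hX : X ≤ (1 + 3 * s) * (8 * Real.pi * a * (l / (l - a)) ^ 3 / V) / (1 - t)) (hN1 : 1 ≤ N) :
    (N - 1) / 2 * X ≤ 4 * Real.pi * a * rho + 1600 * rho * a * t := by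
  have hpi := Real.pi_pos
  have h1t : 0 < 1 - t := by linarith
  have hl : 0 < l := by
    rw [hatl] at ha
    exact pos_of_mul_pos_right ha ht0.le
  have hfac : l / (l - a) = (1 - t)⁻¹ := by
    have : l - a = l * (1 - t) := by rw [hatl]; ring
    rw [this]; field_simp
  have hinv : (1 - t)⁻¹ ≤ 1 + 2 * t := by
    rw [inv_le_comm₀ h1t (by positivity), ← one_div, div_le_iff₀ (by positivity)]
    nlinarith
  rw [hfac] at hX
  calc (N - 1) / 2 * X
      ≤ (N - 1) / 2 * ((1 + 3 * s) * (8 * Real.pi * a * (1 - t)⁻¹ ^ 3 / V) / (1 - t)) :=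
        mul_le_mul_of_nonneg_left hX (by linarith)
    _ ≤ rho * V / 2 * ((1 + 3 * s) * (8 * Real.pi * a * (1 - t)⁻¹ ^ 3 / V) / (1 - t)) := by
        refine mul_le_mul_of_nonneg_right (by linarith) ?_
        positivity
    _ = 4 * Real.pi * a * rho * ((1 + 3 * s) * (1 - t)⁻¹ ^ 4) := by
        field_simp; ring
    _ ≤ 4 * Real.pi * a * rho * ((1 + 2 * t) * (1 + 2 * t) ^ 4) :=
        mul_le_mul_of_nonneg_left (mul_le_mul (by linarith)
          (pow_le_pow_left₀ (by positivity) hinv 4) (by positivity) (by positivity))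
          (by positivity)
    _ ≤ 4 * Real.pi * a * rho * (1 + 100 * t) := by
        refine mul_le_mul_of_nonneg_left ?_ (by positivity)
        have e : (1 + 2 * t) * (1 + 2 * t) ^ 4 = 1 + t * (10 + 40 * t + 80 * t ^ 2 + 80 * t ^ 3
          + 32 * t ^ 4) := by ring
        rw [e]
        have h2 : t ^ 2 ≤ (1 / 4) ^ 2 := by gcongr
        have h3 : t ^ 3 ≤ (1 / 4) ^ 3 := by gcongr
        have h4 : t ^ 4 ≤ (1 / 4) ^ 4 := by gcongr
        nlinarith
    _ ≤ _ := by
        have : 0 < rho * a * t := by positivity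
        nlinarith [Real.pi_le_four]

/-- The two-body term in a finite box. -/
theorem IsNeumannGroundState.twoBodyTerm_le {rho t : ℝ} {n : ℕ} (ha : 0 < a) (hal : a < l)
    (h : IsNeumannGroundState a l lam f) (hL : 0 < L) (hn : n ≠ 0)
    (hdens : ((n + 2 : ℕ) : ℝ) = rho * L ^ 3) (hrho : 0 < rho) (ht : t = a / l) (ht4 : t ≤ 1 / 4)
    (hsmall : 36 * Real.pi * (rho * a * l ^ 2) ≤ 1)
    (hlarge : 8 * Real.pi * a * l ^ 2 / L ^ 3 ≤ t) :
    0 < jastrowNormSq (n + 2) L f ∧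
      twoBodyTerm (n + 2) L l lam f ≤ 4 * Real.pi * a * rho + 1600 * rho * a * t := by
  have : Fact (0 < L) := ⟨hL⟩
  obtain ⟨hlam, -, hmeas, hrad, h0, h1, -⟩ := h.bounds ha hal
  have hpi := Real.pi_pos
  have hl : 0 < l := ha.trans hal
  have hL3 : 0 < L ^ 3 := by positivity
  have ht0 : 0 < t := ht ▸ div_pos ha hl
  have hatl : a = t * l := by rw [ht]; field_simp
  have hφ := h.isConvWeight (L := L) ha hal
  have hI := h.integral_potential_le (L := L) ha hal
  set p := 4 * Real.pi * a * l ^ 2 / L ^ 3 with hp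
  set q := 16 * Real.pi * a ^ 2 * l / L ^ 3 with hq
  set φ : Torus L → ℝ := fun y => f (torusLift L y) ^ 2 with hφdef
  set ψ : Torus L → ℝ := fun y => potential l lam (torusLift L y) with hψdef
  have hψ : BddMeas ψ := (bddMeas_potential l lam).comp measurable_torusLift
  have hψ0 : ∀ y, 0 ≤ ψ y := fun y => potential_nonneg hlam.le l _
  have hnL : (n : ℝ) ≤ rho * L ^ 3 := by rw [← hdens]; push_cast; linarith
  have hnp : 9 * (n * p) ≤ 1 := by
    refine le_trans ?_ hsmall
    calc 9 * (n * p) ≤ 9 * (rho * L ^ 3 * p) := by gcongr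
      _ = _ := by rw [hp]; field_simp; ring
  have hnq : n * q ≤ 16 * Real.pi * (rho * a * l ^ 2) * t := by
    calc n * q ≤ rho * L ^ 3 * q := by gcongr
      _ = 16 * Real.pi * (rho * a * l * a) := by rw [hq]; field_simp
      _ = 16 * Real.pi * (rho * a * l * (t * l)) := by rw [← hatl]
      _ = _ := by ring
  have hnq' : n * q ≤ t / 2 := by nlinarith
  have hqp : q ≤ p := by
    refine div_le_div_of_nonneg_right ?_ hL3.le
    have : 4 * a ≤ l := by nlinarith
    nlinarith [mul_pos (mul_pos hpi ha) hl]
  obtain ⟨hpos, hmain⟩ := hφ.two_body hn hnp hqp hψ hψ0 fun y =>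
    potential_eq_of_norm_eq l lam (norm_torusLift_neg y)
  have hW := hφ.isPairWeight.bddMeas_gibbsWeight (n := n + 2)
  -- the Jastrow factor is, by definition, the Gibbs weight of the projection to the torus
  have hden : jastrowNormSq (n + 2) L f = (L ^ 3) ^ (n + 2) * ∫ x : Fin (n + 2) → Torus L,
      gibbsWeight (fun x y => φ (x - y)) x ∂(Measure.pi fun _ => torusMeasure L) :=
    integral_box hW.meas
  have hnum : ∫ x in box (n + 2) L, potential l lam (torusRep L (x 0 - x 1)) *
      jastrowSq (n + 2) L f x = (L ^ 3) ^ (n + 2) * ∫ x : Fin (n + 2) → Torus L, ψ (x 0 - x 1) *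
      gibbsWeight (fun x y => φ (x - y)) x ∂(Measure.pi fun _ => torusMeasure L) :=
    integral_box (Φ := fun x : Fin (n + 2) → Torus L => ψ (x 0 - x 1) *
      gibbsWeight (fun x y => φ (x - y)) x) ((hψ.comp (by fun_prop)).mul hW).meas
  set Num := ∫ x : Fin (n + 2) → Torus L, ψ (x 0 - x 1) *
    gibbsWeight (fun x y => φ (x - y)) x ∂(Measure.pi fun _ => torusMeasure L)
  set Den := ∫ x : Fin (n + 2) → Torus L,
    gibbsWeight (fun x y => φ (x - y)) x ∂(Measure.pi fun _ => torusMeasure L)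
  have hpow : 0 < (L ^ 3) ^ (n + 2) := by positivity
  refine ⟨hden ▸ mul_pos hpow hpos, ?_⟩
  unfold twoBodyTerm
  rw [hden, hnum, mul_div_mul_left _ _ hpow.ne']
  have h2p : 2 * p ≤ t := by rw [hp]; refine le_trans (le_of_eq ?_) hlarge; ring
  have h1t : 0 < 1 - t := by linarith
  have hq0 : 0 ≤ n * q := by positivity
  have hratio : Num / Den ≤ (1 + 3 * (n * q)) *
      (8 * Real.pi * a * (l / (l - a)) ^ 3 / L ^ 3) / (1 - t) := by
    have hNum0 : 0 ≤ Num := integral_nonneg fun x =>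
      mul_nonneg (hψ0 _) (hφ.isPairWeight.gibbsWeight_nonneg x)
    rw [div_le_div_iff₀ hpos h1t]
    calc Num * (1 - t) ≤ (1 - 2 * p) * Num := by nlinarith
      _ ≤ _ := hmain
      _ ≤ _ := by gcongr
  exact half_mul_le_energy ha hrho hL3 hdens hatl ht0 ht4 hq0 hnq' hratio
    (by push_cast; linarith [n.cast_nonneg (α := ℝ)])

end Estimate

section Scaling

variable {rho a eps : ℝ}

theorem div_corrLength (hrho : 0 < rho) (ha : 0 < a) :
    a / corrLength rho a eps = (rho * a ^ 3) ^ (1 / 2 - eps) := by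
  have h1 : 0 < rho * a := by positivity
  have h2 : 0 < rho * a ^ 3 := by positivity
  have h3 : a = (rho * a) ^ (-(1 / 2) : ℝ) * (rho * a ^ 3) ^ (1 / 2 : ℝ) := by
    have e : rho * a ^ 3 = (rho * a) * a ^ 2 := by ring
    rw [e, Real.mul_rpow h1.le (by positivity), ← mul_assoc, ← Real.rpow_add h1]
    norm_num
    rw [← Real.sqrt_eq_rpow, Real.sqrt_sq ha.le]
  unfold corrLength
  nth_rewrite 1 [h3]
  rw [mul_div_mul_left _ _ (Real.rpow_pos_of_pos h1 _).ne', Real.rpow_sub h2]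

theorem rho_mul_corrLength_sq (hrho : 0 < rho) (ha : 0 < a) :
    rho * a * corrLength rho a eps ^ 2 = (rho * a ^ 3) ^ (2 * eps) := by
  have h1 : 0 < rho * a := by positivity
  have h2 : 0 < rho * a ^ 3 := by positivity
  unfold corrLength
  rw [mul_pow, ← Real.rpow_mul_natCast h1.le, ← Real.rpow_mul_natCast h2.le, ← mul_assoc]
  norm_num
  rw [Real.rpow_neg_one, mul_inv_cancel₀ h1.ne', one_mul, mul_comm eps 2]

theorem sideLength_pow (hrho : 0 < rho) (N : ℕ) : sideLength rho N ^ 3 = N / rho := by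
  unfold sideLength
  rw [← Real.rpow_natCast, ← Real.rpow_mul (by positivity)]
  norm_num

end Scaling

end HardSphere

theorem proposition2 (eps : ℝ) (heps : 0 < eps) (heps' : eps < 1 / 2) :
    ∃ C : ℝ, 0 < C ∧ ∃ delta : ℝ, 0 < delta ∧
      ∀ rho a : ℝ, 0 < rho → 0 < a → rho * a ^ 3 < delta →
      ∀ (lam : ℝ) (f : HardSphere.R3 → ℝ),
        HardSphere.IsNeumannGroundState a (HardSphere.corrLength rho a eps) lam f →
        (∀ᶠ n : ℕ in Filter.atTop,
          0 < HardSphere.jastrowNormSq (n + 2) (HardSphere.sideLength rho (n + 2)) f) ∧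
        Filter.limsup
            (fun n : ℕ =>
              ((HardSphere.twoBodyTerm (n + 2) (HardSphere.sideLength rho (n + 2))
                (HardSphere.corrLength rho a eps) lam f : ℝ) : EReal))
            Filter.atTop ≤
          ((4 * Real.pi * a * rho + C * rho * a * (rho * a ^ 3) ^ (1 / 2 - eps) : ℝ) : EReal) := by
  have hpi := Real.pi_pos
  -- the two bounds on `delta` make `a / l` and `rho a l ^ 2` small
  refine ⟨1600, by norm_num, min ((1 / 4) ^ (1 / 2 - eps)⁻¹)
    ((36 * Real.pi)⁻¹ ^ (2 * eps)⁻¹), by positivity, ?_⟩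
  intro rho a hrho ha hsmall lam f h
  set l := HardSphere.corrLength rho a eps with hl
  have hx : 0 < rho * a ^ 3 := by positivity
  have hl0 : 0 < l := by
    have h1 : 0 < rho * a := by positivity
    exact mul_pos (Real.rpow_pos_of_pos h1 _) (Real.rpow_pos_of_pos hx _)
  have ht : (rho * a ^ 3) ^ (1 / 2 - eps) = a / l := (HardSphere.div_corrLength hrho ha).symm
  have ht4 : (rho * a ^ 3) ^ (1 / 2 - eps) ≤ 1 / 4 := by
    rw [← Real.le_rpow_inv_iff_of_pos hx.le (by norm_num) (by linarith)]
    exact hsmall.le.trans (min_le_left _ _)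
  have hs : 36 * Real.pi * (rho * a * l ^ 2) ≤ 1 := by
    have : (rho * a ^ 3) ^ (2 * eps) ≤ (36 * Real.pi)⁻¹ := by
      rw [← Real.le_rpow_inv_iff_of_pos hx.le (by positivity) (by linarith)]
      exact hsmall.le.trans (min_le_right _ _)
    rw [hl, HardSphere.rho_mul_corrLength_sq hrho ha]
    calc _ ≤ 36 * Real.pi * (36 * Real.pi)⁻¹ := by gcongr
      _ = 1 := mul_inv_cancel₀ (by positivity)
  have hal : a < l := by
    rw [ht, div_le_iff₀ hl0] at ht4
    linarith
  set t := (rho * a ^ 3) ^ (1 / 2 - eps) with htdef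
  have ht0 : 0 < t := ht ▸ div_pos ha hl0
  -- the volume tends to infinity
  have hlarge : ∀ᶠ n : ℕ in Filter.atTop,
      8 * Real.pi * a * l ^ 2 / HardSphere.sideLength rho (n + 2) ^ 3 ≤ t := by
    obtain ⟨m, hm⟩ := exists_nat_ge (8 * Real.pi * a * l ^ 2 * rho / t)
    filter_upwards [Filter.eventually_ge_atTop m] with n hn
    have hn' : (m : ℝ) ≤ n := by exact_mod_cast hn
    rw [HardSphere.sideLength_pow hrho, div_div_eq_mul_div, div_le_iff₀ (by positivity)]
    rw [div_le_iff₀ ht0] at hm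
    push_cast
    nlinarith
  have hboth : ∀ᶠ n : ℕ in Filter.atTop,
      0 < HardSphere.jastrowNormSq (n + 2) (HardSphere.sideLength rho (n + 2)) f ∧
      HardSphere.twoBodyTerm (n + 2) (HardSphere.sideLength rho (n + 2)) l lam f ≤
        4 * Real.pi * a * rho + 1600 * rho * a * t := by
    filter_upwards [hlarge, Filter.eventually_ge_atTop 1] with n hn hn1
    have hL : 0 < HardSphere.sideLength rho (n + 2) := Real.rpow_pos_of_pos (by positivity) _
    refine h.twoBodyTerm_le ha hal hL (by omega) ?_ hrho ht ht4 hs hn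
    rw [HardSphere.sideLength_pow hrho]
    field_simp
  exact ⟨hboth.mono fun n hn => hn.1,
    Filter.limsup_le_of_le (h := hboth.mono fun n hn => EReal.coe_le_coe_iff.2 hn.2)⟩
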